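/- All graphs are finite, simple and undirected. For a function $f\colon V\to\{0,1,2\}$ on the vertex set of a graph $G=(V,E)$, a vertex $u$ is \emph{undefended} by $f$ if $f(u)=0$ and $f(v)=0$ for every neighbour $v$ of $u$. The function $f$ is a \emph{weak Roman dominating function} of $G$ if every vertex $u$ with $f(u)=0$ has a neighbour $v$ with $f(v)\ge 1$ such that no vertex is undefended by the function $f'$ given by $f'(u)=1$, $f'(v)=f(v)-1$ and $f'(w)=f(w)$ for all other $w$. The \emph{weak Roman domination number} $\gamma_r(G)$ is the minimum of $\sum_{v\in V}f(v)$ over all weak Roman dominating functions $f$ of $G$. The graph $G$ is \emph{$P_4$-sparse} if every set of five vertices contains at most one four-element subset that induces a path $P_4$ in $G$. \textbf{Theorem.} Given a connected $P_4$-sparse graph $G$ on $n$ vertices, $\gamma_r(G)$ can be computed in $O(n^3)$ time. That is, there are a single program for the word RAM and constants $c$ and $C$ such that, for every $n\ge 1$ and every connected $P_4$-sparse graph $G$ with vertex set $\{0,\dots,n-1\}$, the program, started on $n$ and the adjacency matrix of $G$, halts after at most $C\,n^3$ steps with output $\gamma_r(G)$. Here the word RAM has finitely many registers and arrays, each register and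 array cell holds a natural number less than $(n+2)^c$ (a word of $O(\log n)$ bits), no larger value may arise, and each register access, array access, constant, addition, truncated subtraction, multiplication, comparison, assignment and test takes one step. -/

import Mathlib

/-! ### Weak Roman domination -/

namespace WeakRoman

/-- A vertex `u` is undefended by `f` if it carries the value `0` and has no neighbour with a
positive value. -/
def Undefended {V : Type*} (G : SimpleGraph V) (f : V → ℕ) (u : V) : Prop :=
  f u = 0 ∧ ∀ v, G.Adj u v → f v = 0

/-- The function obtained from `f` by moving one legion from `v` to `u`: the value at `u` becomes
`1`, the value at `v` drops by one, and all other values are unchanged. -/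
def move {V : Type*} [DecidableEq V] (f : V → ℕ) (v u : V) : V → ℕ :=
  fun w => if w = u then 1 else if w = v then f v - 1 else f w

/-- `f : V → {0, 1, 2}` is a weak Roman dominating function: every vertex `u` of value `0` has a
neighbour `v` of positive value such that, after moving one legion from `v` to `u`, no vertex is
undefended. -/
def IsWRD {V : Type*} [DecidableEq V] (G : SimpleGraph V) (f : V → ℕ) : Prop :=
  (∀ v, f v ≤ 2) ∧
    ∀ u, f u = 0 → ∃ v, G.Adj u v ∧ 0 < f v ∧ ∀ w, ¬ Undefended G (move f v u) w

/-- The weak Roman domination number: the minimum weight `∑ v, f v` of a weak Roman dominating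
function `f`. -/
noncomputable def gammaR {V : Type*} [Fintype V] [DecidableEq V] (G : SimpleGraph V) : ℕ :=
  sInf {k | ∃ f : V → ℕ, IsWRD G f ∧ ∑ v, f v = k}

/-- The minimum in the definition of `gammaR` is attained. -/
theorem gammaR_spec {V : Type*} [Fintype V] [DecidableEq V] (G : SimpleGraph V) :
    IsLeast {k | ∃ f : V → ℕ, IsWRD G f ∧ ∑ v, f v = k} (gammaR G) :=
  ⟨Nat.sInf_mem ⟨_, fun _ => 1, ⟨fun _ => by norm_num, fun _ h => absurd h one_ne_zero⟩, rfl⟩,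
    fun _ hk => Nat.sInf_le hk⟩

/-! ### P₄-sparse graphs -/

/-- The vertex set `s` induces a path on four vertices in `G`. -/
def InducesP4 {V : Type*} (G : SimpleGraph V) (s : Finset V) : Prop :=
  Nonempty (G.induce (s : Set V) ≃g SimpleGraph.pathGraph 4)

/-- `G` is `P₄`-sparse: every set of five vertices contains at most one induced `P₄`. -/
def IsP4Sparse {V : Type*} (G : SimpleGraph V) : Prop :=
  ∀ s : Finset V, s.card = 5 → ∀ p ⊆ s, ∀ q ⊆ s, InducesP4 G p → InducesP4 G q → p = q

/-! ### Word RAM programs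

A program uses finitely many registers and finitely many arrays (both named by numerals that occur
in the program); every register and every array cell holds one machine word, that is, a natural
number smaller than a bound `W`.  Each elementary operation takes one step.  There is no
wrap-around: a computation in which a value `≥ W` arises is stuck and does not terminate. -/

/-- The contents of the registers and of the arrays. -/
structure Store where
  reg : ℕ → ℕ
  arr : ℕ → ℕ → ℕ

/-- Arithmetic expressions: constants, registers, array cells, sum, truncated difference, product,
and the comparisons `<` and `=` with the values `1` (true) and `0` (false). -/
inductive Expr : Type
  | const (k : ℕ)
  | reg (r : ℕ)
  | cell (a : ℕ) (i : Expr)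
  | add (x y : Expr)
  | sub (x y : Expr)
  | mul (x y : Expr)
  | lt (x y : Expr)
  | eq (x y : Expr)

/-- The value of an expression. -/
def Expr.eval (σ : Store) : Expr → ℕ
  | .const k => k
  | .reg r => σ.reg r
  | .cell a i => σ.arr a (i.eval σ)
  | .add x y => x.eval σ + y.eval σ
  | .sub x y => x.eval σ - y.eval σ
  | .mul x y => x.eval σ * y.eval σ
  | .lt x y => if x.eval σ < y.eval σ then 1 else 0
  | .eq x y => if x.eval σ = y.eval σ then 1 else 0

/-- The number of steps needed to evaluate an expression: one for each constant, register access,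
array access and operation in it. -/
def Expr.cost : Expr → ℕ
  | .const _ => 1
  | .reg _ => 1
  | .cell _ i => i.cost + 1
  | .add x y => x.cost + y.cost + 1
  | .sub x y => x.cost + y.cost + 1
  | .mul x y => x.cost + y.cost + 1
  | .lt x y => x.cost + y.cost + 1
  | .eq x y => x.cost + y.cost + 1

/-- All values that arise in the evaluation of the expression, array indices included, are smaller
than `W`. -/
def Expr.Fits (W : ℕ) (σ : Store) : Expr → Prop
  | .const k => k < W
  | .reg r => σ.reg r < W
  | .cell a i => i.Fits W σ ∧ σ.arr a (i.eval σ) < W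
  | .add x y => x.Fits W σ ∧ y.Fits W σ ∧ x.eval σ + y.eval σ < W
  | .sub x y => x.Fits W σ ∧ y.Fits W σ
  | .mul x y => x.Fits W σ ∧ y.Fits W σ ∧ x.eval σ * y.eval σ < W
  | .lt x y => x.Fits W σ ∧ y.Fits W σ ∧ 1 < W
  | .eq x y => x.Fits W σ ∧ y.Fits W σ ∧ 1 < W

/-- Programs. A condition is true if its value is not `0`. -/
inductive Program : Type
  | skip
  | setReg (r : ℕ) (x : Expr)
  | setCell (a : ℕ) (i x : Expr)
  | seq (p q : Program)
  | cond (x : Expr) (p q : Program)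
  | loop (x : Expr) (p : Program)

/-- The store after the assignment of `k` to register `r`. -/
def Store.setReg (σ : Store) (r k : ℕ) : Store :=
  { σ with reg := Function.update σ.reg r k }

/-- The store after the assignment of `k` to cell `i` of array `a`. -/
def Store.setCell (σ : Store) (a i k : ℕ) : Store :=
  { σ with arr := Function.update σ.arr a (Function.update (σ.arr a) i k) }

/-- `Exec W p σ t τ`: on a machine whose words are the numbers smaller than `W`, the program `p`,
started in the store `σ`, terminates after exactly `t` steps in the store `τ`. Here `cond x p q` is
"if `x` then `p` else `q`" and `loop x p` is "while `x` do `p`". -/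
inductive Exec (W : ℕ) : Program → Store → ℕ → Store → Prop
  | skip (σ : Store) : Exec W .skip σ 1 σ
  | setReg (σ : Store) (r : ℕ) (x : Expr) (hx : x.Fits W σ) :
      Exec W (.setReg r x) σ (x.cost + 1) (σ.setReg r (x.eval σ))
  | setCell (σ : Store) (a : ℕ) (i x : Expr) (hi : i.Fits W σ) (hx : x.Fits W σ) :
      Exec W (.setCell a i x) σ (i.cost + x.cost + 1) (σ.setCell a (i.eval σ) (x.eval σ))
  | seq {p q : Program} {σ τ υ : Store} {s t : ℕ} (hp : Exec W p σ s τ) (hq : Exec W q τ t υ) :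
      Exec W (.seq p q) σ (s + t) υ
  | condTrue {x : Expr} {p q : Program} {σ τ : Store} {t : ℕ} (hx : x.Fits W σ)
      (h : x.eval σ ≠ 0) (hp : Exec W p σ t τ) : Exec W (.cond x p q) σ (x.cost + 1 + t) τ
  | condFalse {x : Expr} {p q : Program} {σ τ : Store} {t : ℕ} (hx : x.Fits W σ)
      (h : x.eval σ = 0) (hq : Exec W q σ t τ) : Exec W (.cond x p q) σ (x.cost + 1 + t) τ
  | loopTrue {x : Expr} {p : Program} {σ τ υ : Store} {s t : ℕ} (hx : x.Fits W σ)
      (h : x.eval σ ≠ 0) (hp : Exec W p σ s τ) (hl : Exec W (.loop x p) τ t υ) :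
      Exec W (.loop x p) σ (x.cost + 1 + s + t) υ
  | loopFalse {x : Expr} {p : Program} {σ : Store} (hx : x.Fits W σ) (h : x.eval σ = 0) :
      Exec W (.loop x p) σ (x.cost + 1) σ

open Classical in
/-- The initial store for a graph on `n` vertices: register `0` holds `n`, array `0` holds the
adjacency matrix row by row (cell `n * i + j` is `1` if the vertices `i` and `j` are adjacent, and
`0` otherwise), and everything else is `0`. -/
noncomputable def graphInput {n : ℕ} (G : SimpleGraph (Fin n)) : Store where
  reg r := if r = 0 then n else 0
  arr a k := if a = 0 ∧ ∃ i j : Fin n, k = n * i + j ∧ G.Adj i j then 1 else 0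

end WeakRoman

namespace WeakRoman

/-! ### The local structure of `P₄`-sparse graphs -/

section Structure

variable {V : Type*} {G : SimpleGraph V}

/-! Sparseness enters only through `Typed`: a vertex outside an induced path on four vertices sees
all of it, none of it, or exactly its two midpoints. This property passes to complements and induced
subgraphs, and it drives every structural step.

The value of the weak Roman domination number is a case distinction, `gammaR_eq`. Values one and two
are characterised in every graph, by completeness and by secure pairs; when both fail, no vertex is
universal. If there is a pendant vertex, typing forces a thin spider: the pendant vertices are the
legs, their neighbours are distinct feet, and a foot sees every vertex that is not a leg. Each leg
together with its foot needs a legion, so the value is the number of legs, plus one if a head exists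
(`gammaR_eq_of_pendant`).

If there is no pendant vertex and the complement is connected, then the complement has a pendant
vertex (`exists_pendant`, by deleting vertices one at a time). Three vertices of this thick spider
dominate pairwise, so three legions suffice. If the complement is disconnected, the graph is a join.
One vertex from each side gives a dominating pair, so the value is at most four. Of three legions
two stand on the same side, and these two together with any vertex of the other side form a clique
triple; so the value three is equivalent to the existence of such a triple.

Testing directly, for all pairs, that the missed vertices form a clique takes too long. By the
exchange argument in `CliqueTriple.exists_twins` the missed vertices may be assumed to be true
twins, and `sum_card_twins_eq_iff` turns this into a comparison of two sums over one vertex. Once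
the dominating pairs and the numbers of twins are tabulated, the whole formula is an arithmetic term
whose sums are nested at most three deep. `Tm.runs_compile` evaluates any such term in time
proportional to a power of `n + 1` whose exponent is the nesting depth, with polynomially bounded
words. -/

/-- The vertices `a`, `b`, `c`, `d` form, in this order, an induced path. -/
structure IsPath4 (G : SimpleGraph V) (a b c d : V) : Prop where
  ab : G.Adj a b
  bc : G.Adj b c
  cd : G.Adj c d
  ac : ¬ G.Adj a c
  bd : ¬ G.Adj b d
  ad : ¬ G.Adj a d
  nac : a ≠ c
  nbd : b ≠ d
  nad : a ≠ d

/-- Every vertex outside an induced `P₄` is adjacent to all of it, to none of it, or exactly to its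
two midpoints. -/
def Typed (G : SimpleGraph V) : Prop :=
  ∀ a b c d v, IsPath4 G a b c d → v ≠ a → v ≠ b → v ≠ c → v ≠ d →
    (G.Adj v a ∧ G.Adj v b ∧ G.Adj v c ∧ G.Adj v d) ∨
    (¬ G.Adj v a ∧ ¬ G.Adj v b ∧ ¬ G.Adj v c ∧ ¬ G.Adj v d) ∨
    (¬ G.Adj v a ∧ G.Adj v b ∧ G.Adj v c ∧ ¬ G.Adj v d)

theorem IsPath4.inducesP4 [DecidableEq V] {a b c d : V} (h : IsPath4 G a b c d) :
    InducesP4 G {a, b, c, d} := by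
  obtain ⟨ab, bc, cd, ac, bd, ad, nac, nbd, nad⟩ := h
  have nab := ab.ne
  have nbc := bc.ne
  have ncd := cd.ne
  let f : Fin 4 → (({a, b, c, d} : Finset V) : Set V) :=
    ![⟨a, by simp⟩, ⟨b, by simp⟩, ⟨c, by simp⟩, ⟨d, by simp⟩]
  have hf : Function.Bijective f := by
    constructor
    · intro i j hij
      fin_cases i <;> fin_cases j <;>
        simp [f, nab, nbc, ncd, nac, nbd, nad, nab.symm, nbc.symm, ncd.symm, nac.symm, nbd.symm,
          nad.symm] at hij ⊢
    · rintro ⟨x, hx⟩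
      simp only [Finset.coe_insert, Finset.coe_singleton, Set.mem_insert_iff,
        Set.mem_singleton_iff] at hx
      rcases hx with rfl | rfl | rfl | rfl
      exacts [⟨0, rfl⟩, ⟨1, rfl⟩, ⟨2, rfl⟩, ⟨3, rfl⟩]
  refine ⟨RelIso.symm ⟨Equiv.ofBijective f hf, ?_⟩⟩
  intro i j
  have ba := ab.symm
  have cb := bc.symm
  have dc := cd.symm
  have ca : ¬ G.Adj c a := fun h => ac h.symm
  have db : ¬ G.Adj d b := fun h => bd h.symm
  have da : ¬ G.Adj d a := fun h => ad h.symm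
  fin_cases i <;> fin_cases j <;>
    simp [f, SimpleGraph.pathGraph_adj, ab, bc, cd, ac, bd, ad, ba, cb, dc, ca, db, da]

/-- Every other adjacency pattern of `v` produces a second induced path, one through `v`, inside the
five vertices `v, a, b, c, d`. The facts `p1` to `p8` exclude the patterns one path at a time. -/
theorem IsP4Sparse.typed (h : IsP4Sparse G) : Typed G := by
  classical
  intro a b c d v hp va vb vc vd
  have key : ∀ w x y z, IsPath4 G w x y z →
      v ∈ ({w, x, y, z} : Finset V) → ({w, x, y, z} : Finset V) ⊆ {v, a, b, c, d} → False := by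
    intro w x y z hq hv hs
    have h5 : ({v, a, b, c, d} : Finset V).card = 5 := by
      have := hp.ab.ne
      have := hp.bc.ne
      have := hp.cd.ne
      have := hp.nac
      have := hp.nbd
      have := hp.nad
      rw [Finset.card_insert_of_notMem, Finset.card_insert_of_notMem,
        Finset.card_insert_of_notMem, Finset.card_insert_of_notMem, Finset.card_singleton] <;>
      simp_all
    have := h _ h5 {a, b, c, d} (Finset.subset_insert _ _) _ hs hp.inducesP4 hq.inducesP4
    rw [← this] at hv
    simp only [Finset.mem_insert, Finset.mem_singleton] at hv
    tauto
  obtain ⟨ab, bc, cd, ac, bd, ad, nac, nbd, nad⟩ := hp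
  have ba := ab.symm
  have cb := bc.symm
  have dc := cd.symm
  have ca : ¬ G.Adj c a := fun h => ac h.symm
  have db : ¬ G.Adj d b := fun h => bd h.symm
  have da : ¬ G.Adj d a := fun h => ad h.symm
  have sub : ∀ w x y z : V, (w = v ∨ w = a ∨ w = b ∨ w = c ∨ w = d) →
      (x = v ∨ x = a ∨ x = b ∨ x = c ∨ x = d) → (y = v ∨ y = a ∨ y = b ∨ y = c ∨ y = d) →
      (z = v ∨ z = a ∨ z = b ∨ z = c ∨ z = d) →
      ({w, x, y, z} : Finset V) ⊆ {v, a, b, c, d} := by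
    intro w x y z hw hx hy hz t ht
    simp only [Finset.mem_insert, Finset.mem_singleton] at ht ⊢
    rcases ht with rfl | rfl | rfl | rfl <;> assumption
  have key' : ∀ w x y z : V, G.Adj w x → G.Adj x y → G.Adj y z → ¬ G.Adj w y → ¬ G.Adj x z →
      ¬ G.Adj w z → w ≠ y → x ≠ z → w ≠ z → v ∈ ({w, x, y, z} : Finset V) →
      (w = v ∨ w = a ∨ w = b ∨ w = c ∨ w = d) →
      (x = v ∨ x = a ∨ x = b ∨ x = c ∨ x = d) → (y = v ∨ y = a ∨ y = b ∨ y = c ∨ y = d) →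
      (z = v ∨ z = a ∨ z = b ∨ z = c ∨ z = d) → False :=
    fun w x y z h1 h2 h3 h4 h5 h6 h7 h8 h9 hv hw hx hy hz =>
      key w x y z ⟨h1, h2, h3, h4, h5, h6, h7, h8, h9⟩ hv (sub w x y z hw hx hy hz)
  clear key sub h
  have p1 : G.Adj v a → ¬ G.Adj v b → ¬ G.Adj v c → False := fun ha hb hc =>
    key' v a b c ha ab bc hb ac hc vb nac vc (by simp) (by simp) (by simp) (by simp) (by simp)
  have p2 : G.Adj v b → ¬ G.Adj v c → ¬ G.Adj v d → False := fun hb hc hd =>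
    key' v b c d hb bc cd hc bd hd vc nbd vd (by simp) (by simp) (by simp) (by simp) (by simp)
  have p3 : G.Adj v c → ¬ G.Adj v b → ¬ G.Adj v a → False := fun hc hb ha =>
    key' v c b a hc cb ba hb ca ha vb nac.symm va (by simp) (by simp) (by simp) (by simp) (by simp)
  have p4 : G.Adj v d → ¬ G.Adj v c → ¬ G.Adj v b → False := fun hd hc hb =>
    key' v d c b hd dc cb hc db hb vc nbd.symm vb (by simp) (by simp) (by simp) (by simp) (by simp)
  have p5 : G.Adj v a → G.Adj v c → ¬ G.Adj v d → False := fun ha hc hd =>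
    key' a v c d ha.symm hc cd ac hd ad nac vd nad (by simp) (by simp) (by simp) (by simp) (by simp)
  have p6 : G.Adj v b → G.Adj v d → ¬ G.Adj v a → False := fun hb hd ha =>
    key' a b v d ab hb.symm hd (fun h => ha h.symm) bd ad va.symm nbd nad (by simp) (by simp) (by simp) (by simp) (by simp)
  have p7 : G.Adj v a → G.Adj v d → ¬ G.Adj v c → False := fun ha hd hc =>
    key' a v d c ha.symm hd dc ad hc ac nad vc nac (by simp) (by simp) (by simp) (by simp) (by simp)
  have p8 : G.Adj v d → G.Adj v a → ¬ G.Adj v b → False := fun hd ha hb =>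
    key' d v a b hd.symm ha ab da hb db nad.symm vb nbd.symm (by simp) (by simp) (by simp) (by simp) (by simp)
  by_cases ha : G.Adj v a <;> by_cases hb : G.Adj v b <;> by_cases hc : G.Adj v c <;>
    by_cases hd : G.Adj v d <;>
  first
  | exact .inl ⟨ha, hb, hc, hd⟩
  | exact .inr (.inl ⟨ha, hb, hc, hd⟩)
  | exact .inr (.inr ⟨ha, hb, hc, hd⟩)
  | exact (p1 ha hb hc).elim
  | exact (p2 hb hc hd).elim
  | exact (p3 hc hb ha).elim
  | exact (p4 hd hc hb).elim
  | exact (p5 ha hc hd).elim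
  | exact (p6 hb hd ha).elim
  | exact (p7 ha hd hc).elim
  | exact (p8 hd ha hb).elim

/-- The path on four vertices is self-complementary, and complementation swaps ends and midpoints.
"All" and "none" are exchanged, and "only the midpoints" is preserved. -/
theorem Typed.compl (h : Typed G) : Typed Gᶜ := by
  intro a b c d v hp va vb vc vd
  obtain ⟨ab, bc, cd, ac, bd, ad, nac, nbd, nad⟩ := hp
  have nab := ab.ne
  have nbc := bc.ne
  have ncd := cd.ne
  simp only [SimpleGraph.compl_adj] at ab bc cd ac bd ad ⊢
  have hp : IsPath4 G b d a c :=
    ⟨not_not.1 fun h => bd ⟨nbd, h⟩, G.adj_symm (not_not.1 fun h => ad ⟨nad, h⟩),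
      not_not.1 fun h => ac ⟨nac, h⟩, fun h => ab.2 h.symm, fun h => cd.2 h.symm, bc.2,
      nab.symm, ncd.symm, nbc⟩
  have := h b d a c v hp vb vd va vc
  tauto

theorem Typed.induce (h : Typed G) (s : Set V) : Typed (G.induce s) := by
  intro a b c d v hp va vb vc vd
  obtain ⟨ab, bc, cd, ac, bd, ad, nac, nbd, nad⟩ := hp
  have e : ∀ {x y : s}, x ≠ y → (x : V) ≠ y := fun h => Subtype.coe_injective.ne h
  exact h a b c d v ⟨ab, bc, cd, ac, bd, ad, e nac, e nbd, e nad⟩ (e va) (e vb) (e vc) (e vd)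

/-- In a connected graph a nonempty set closed under adjacency contains every vertex. -/
theorem mem_of_connected (hG : G.Connected) {p : V → Prop} {a : V} (ha : p a)
    (hp : ∀ x y, p x → G.Adj x y → p y) (b : V) : p b := by
  obtain ⟨w⟩ := hG.preconnected a b
  induction w with
  | nil => exact ha
  | cons hadj _ ih => exact ih (hp _ _ ha hadj)

/-- In a disconnected graph there is a nontrivial set of vertices closed under adjacency. -/
theorem exists_closed_of_not_connected [Nonempty V] (hG : ¬ G.Connected) :
    ∃ p : V → Prop, (∃ a, p a) ∧ (∃ b, ¬ p b) ∧ ∀ x y, G.Adj x y → (p x ↔ p y) := by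
  have : ¬ G.Preconnected := fun h => hG ⟨h⟩
  simp only [SimpleGraph.Preconnected, not_forall] at this
  obtain ⟨a, b, hab⟩ := this
  exact ⟨G.Reachable a, ⟨a, .rfl⟩, ⟨b, hab⟩,
    fun x y h => ⟨fun hx => hx.trans h.reachable, fun hy => hy.trans h.symm.reachable⟩⟩

/-- `v` is adjacent to `w` or equal to it. -/
def CAdj (G : SimpleGraph V) (v w : V) : Prop := v = w ∨ G.Adj v w

theorem CAdj.symm {v w : V} (h : CAdj G v w) : CAdj G w v := h.imp Eq.symm fun h => h.symm

theorem cAdj_refl (v : V) : CAdj G v v := .inl rfl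

theorem CAdj.adj {v w : V} (h : CAdj G v w) (hne : v ≠ w) : G.Adj v w := h.resolve_left hne

/-- `c` is the only neighbour of `s`. -/
def PendantAt (G : SimpleGraph V) (s c : V) : Prop := G.Adj s c ∧ ∀ w, G.Adj s w → w = c

/-- `s` has exactly one neighbour. -/
def Pendant (G : SimpleGraph V) (s : V) : Prop := ∃ c, PendantAt G s c

/-- The vertices not dominated by the neighbour of a pendant vertex are pendant, with private
neighbours: the graph is a thin spider. -/
theorem thin_spider (hG : G.Connected) (ht : Typed G) {s c : V} (hs : PendantAt G s c) {m : V}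
    (hm : ¬ CAdj G c m) :
    ∃ x, PendantAt G m x ∧ G.Adj c x ∧ (∀ y, y ≠ x → y ≠ s → G.Adj c y → G.Adj x y) ∧
      ∀ y, ¬ CAdj G c y → y ≠ m → ¬ G.Adj x y := by
  obtain ⟨hsc, hs⟩ := hs
  -- The pendant vertex `s`, its neighbour `c` and a vertex `m` reached from `c` through `x` form an
  -- induced path. Typing with respect to these paths gives all the claims.
  have path : ∀ x m, ¬ CAdj G c m → G.Adj c x → G.Adj x m → IsPath4 G s c x m := by
    intro x m hm hcx hxm
    have hxs : s ≠ x := by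
      rintro rfl
      exact hm (.inl (hs _ hxm).symm)
    refine ⟨hsc, hcx, hxm, fun h => hcx.ne (hs _ h).symm, fun h => hm (.inr h),
      fun h => hm (.inl (hs _ h).symm), hxs, fun h => hm (.inl h), ?_⟩
    rintro rfl
    exact hm (.inr hsc.symm)
  -- No vertex is farther than two from `c`: a neighbour of the far end `v` of a path `s, c, x, v`
  -- must see the whole path, hence also `x`.
  have dist2 : ∀ m, CAdj G c m ∨ ∃ x, G.Adj c x ∧ G.Adj x m := by
    refine mem_of_connected hG (a := c) (.inl (cAdj_refl c)) ?_
    intro v z hv hvz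
    by_cases hcz : CAdj G c z
    · exact .inl hcz
    by_cases hcv : CAdj G c v
    · rcases hcv with rfl | hcv
      · exact (hcz (.inr hvz)).elim
      · exact .inr ⟨v, hcv, hvz⟩
    obtain ⟨x, hcx, hxv⟩ := hv.resolve_left hcv
    by_cases hzx : G.Adj z x
    · exact .inr ⟨x, hcx, hzx.symm⟩
    have hp := path x v hcv hcx hxv
    have hzs : z ≠ s := by
      rintro rfl
      exact hcz (.inr hsc.symm)
    have hzx' : z ≠ x := by
      rintro rfl
      exact hcz (.inr hcx)
    rcases ht _ _ _ _ z hp hzs (fun h => hcz (.inl h.symm)) hzx' hvz.ne.symm with h | h | h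
    · exact (hzx h.2.2.1).elim
    · exact (h.2.2.2 hvz.symm).elim
    · exact (hzx h.2.2.1).elim
  obtain ⟨x, hcx, hxm⟩ := (dist2 m).resolve_left hm
  have hp := path x m hm hcx hxm
  have key := fun y h1 h2 h3 h4 => ht _ _ _ _ y hp h1 h2 h3 h4
  refine ⟨x, ⟨hxm.symm, fun y hmy => ?_⟩, hcx, fun y hyx hys hcy => ?_, fun y hcy hym hxy => ?_⟩
  · by_contra hyx
    have hys : y ≠ s := by
      rintro rfl
      exact hm (.inl (hs _ hmy.symm).symm)
    have hyc : y ≠ c := by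
      rintro rfl
      exact hm (.inr hmy.symm)
    rcases key y hys hyc hyx hmy.ne.symm with h | h | h
    · exact hyc (hs _ h.1.symm)
    · exact h.2.2.2 hmy.symm
    · exact h.2.2.2 hmy.symm
  · have hym : y ≠ m := by
      rintro rfl
      exact hm (.inr hcy)
    rcases key y hys hcy.ne.symm hyx hym with h | h | h
    · exact h.2.2.1.symm
    · exact (h.2.1 hcy.symm).elim
    · exact h.2.2.1.symm
  · have hys : y ≠ s := by
      rintro rfl
      exact hcy (.inr hsc.symm)
    rcases key y hys (fun h => hcy (.inl h.symm)) hxy.ne.symm hym with h | h | h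
    · exact hcy (.inr h.2.1.symm)
    · exact h.2.2.1 hxy.symm
    · exact hcy (.inr h.2.1.symm)

end Structure

/-! ### Pendant vertices in connected graphs with connected complement -/

section Spider

variable {V : Type*} {G : SimpleGraph V}

theorem exists_adj_of_connected (hG : G.Connected) {a b : V} (hab : a ≠ b) : ∃ x, G.Adj a x := by
  by_contra! h
  exact hab (mem_of_connected hG (p := fun x => a = x) rfl
    (fun x y hx hxy => (h y (hx ▸ hxy)).elim) b)

theorem exists_not_cAdj (hG : Gᶜ.Connected) {a b : V} (hab : a ≠ b) : ∃ x, ¬ CAdj G a x := by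
  obtain ⟨x, hx⟩ := exists_adj_of_connected hG hab
  rw [SimpleGraph.compl_adj] at hx
  exact ⟨x, fun h => h.elim hx.1 hx.2⟩

/-- A cut vertex that is not adjacent to all vertices of one side is adjacent to a pendant vertex
of the other side. -/
theorem exists_pendantAt_of_cut (hG : G.Connected) (ht : Typed G) {v : V} {P Q : V → Prop}
    (hPQ : ∀ w, w ≠ v → (P w ∨ Q w)) (hP : ∀ w, P w → w ≠ v ∧ ¬ Q w) (hQv : ¬ Q v)
    (hadj : ∀ x y, P x → Q y → ¬ G.Adj x y) (hy : ∃ y, P y ∧ ¬ G.Adj v y) (hq : ∃ q, Q q) :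
    ∃ z, PendantAt G z v := by
  obtain ⟨y₀, hy₀⟩ := hy
  obtain ⟨q, hq⟩ := hq
  -- The path `z, v, x, y` crosses the cut, with `z` in `Q` and `x, y` in `P`. A further neighbour
  -- of the end `z` lies in `Q` and would have to see `x`, against the separation.
  obtain ⟨z, hz, hvz⟩ : ∃ z, Q z ∧ G.Adj z v := by
    by_contra! h
    refine hQv (mem_of_connected hG hq (fun x y hx hxy => ?_) v)
    have hyv : y ≠ v := by
      rintro rfl
      exact h x hx hxy
    exact (hPQ y hyv).resolve_left fun hy => hadj y x hy hx hxy.symm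
  obtain ⟨x, y, hx, hvx, hy, hvy, hxy⟩ :
      ∃ x y, P x ∧ G.Adj v x ∧ P y ∧ ¬ G.Adj v y ∧ G.Adj x y := by
    by_contra! h
    refine (hP v (mem_of_connected (p := fun y => P y ∧ ¬ G.Adj v y) hG hy₀ ?_ v).1).1 rfl
    rintro y x ⟨hy, hvy⟩ hyx
    have hxv : x ≠ v := by
      rintro rfl
      exact hvy hyx.symm
    have hx : P x := (hPQ x hxv).resolve_right fun hx => hadj y x hy hx hyx
    exact ⟨hx, fun hvx => h x y hx hvx hy hvy hyx.symm⟩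
  have hne : ∀ p w, P p → Q w → w ≠ p := by
    rintro p _ hp hw rfl
    exact (hP _ hp).2 hw
  have hp : IsPath4 G z v x y :=
    ⟨hvz, hvx, hxy, fun h => hadj x z hx hz h.symm, hvy, fun h => hadj y z hy hz h.symm,
      hne _ _ hx hz, (hP y hy).1.symm, hne _ _ hy hz⟩
  refine ⟨z, hvz, fun w hzw => ?_⟩
  by_contra hwv
  have hw : Q w := (hPQ w hwv).resolve_left fun hw => hadj w z hw hz hzw.symm
  rcases ht _ _ _ _ w hp hzw.ne.symm hwv (hne _ _ hx hw) (hne _ _ hy hw) with h | h | h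
  · exact hadj x w hx hw h.2.2.1.symm
  · exact h.1 hzw.symm
  · exact hadj x w hx hw h.2.2.1.symm

/-- Connectedness of the complement supplies a non-neighbour `y` of the cut vertex `v`. The side
containing `y` plays the role of `P` in `exists_pendantAt_of_cut`. -/
theorem exists_pendant_of_not_connected (hG : G.Connected) (hc : Gᶜ.Connected) (ht : Typed G)
    {v u : V} (hv : v ≠ u) (h : ¬ (G.induce {v}ᶜ).Connected) : ∃ z, Pendant G z := by
  have : Nonempty ({v}ᶜ : Set V) := ⟨⟨u, hv.symm⟩⟩
  obtain ⟨p, ⟨a, ha⟩, ⟨b, hb⟩, hp⟩ := exists_closed_of_not_connected h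
  obtain ⟨y, hy⟩ := exists_not_cAdj hc hv
  have hyv : y ≠ v := fun h => hy (.inl h.symm)
  have hvy : ¬ G.Adj v y := fun h => hy (.inr h)
  have key : ∀ p : ({v}ᶜ : Set V) → Prop, (∃ b, ¬ p b) →
      (∀ x y, (G.induce {v}ᶜ).Adj x y → (p x ↔ p y)) → p ⟨y, hyv⟩ → ∃ z, Pendant G z := by
    rintro p ⟨b, hb⟩ hp hpy
    obtain ⟨z, hz⟩ := exists_pendantAt_of_cut (v := v) (P := fun w => ∃ h : w ≠ v, p ⟨w, h⟩)
      (Q := fun w => ∃ h : w ≠ v, ¬ p ⟨w, h⟩) hG ht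
      (fun w hw => (em (p ⟨w, hw⟩)).imp (fun h => ⟨hw, h⟩) fun h => ⟨hw, h⟩)
      (fun w ⟨hw, h⟩ => ⟨hw, fun ⟨_, h'⟩ => h' h⟩) (fun ⟨h, _⟩ => h rfl)
      (fun x y ⟨_, hx⟩ ⟨_, hy⟩ hxy => hy ((hp ⟨x, _⟩ ⟨y, _⟩ hxy).1 hx))
      ⟨y, ⟨hyv, hpy⟩, hvy⟩ ⟨b, b.2, hb⟩
    exact ⟨z, v, hz⟩
  by_cases hpy : p ⟨y, hyv⟩
  · exact key p ⟨b, hb⟩ hp hpy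
  · exact key (fun w => ¬ p w) ⟨a, not_not.2 ha⟩ (fun x y h => not_congr (hp x y h)) hpy

theorem compl_induce (s : Set V) : (G.induce s)ᶜ = Gᶜ.induce s := by
  ext x y
  simp [SimpleGraph.compl_adj, Subtype.ext_iff]

/-- The induction step for re-inserting `v` into a thin spider. If `v` misses the leg `s`, then `s`
stays pendant. Otherwise `v` sees an end of each path `s, c, x, m`, hence all of it, so the
non-neighbours of `v` lie in the head. Two of them would violate typing, so `v` has a single
non-neighbour and is pendant in the complement. -/
theorem exists_pendant_of_induce (ht : Typed G) (hc : Gᶜ.Connected) {v : V}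
    (h : (G.induce {v}ᶜ).Connected) (h' : (G.induce {v}ᶜ)ᶜ.Connected)
    (hs : ∃ s, Pendant (G.induce {v}ᶜ) s) : (∃ s, Pendant G s) ∨ ∃ s, Pendant Gᶜ s := by
  obtain ⟨s, c, hsc⟩ := hs
  by_cases hvs : G.Adj v s
  swap
  · refine .inl ⟨s, c, hsc.1, fun w hw => ?_⟩
    have hwv : w ≠ v := by
      rintro rfl
      exact hvs hw.symm
    exact congrArg Subtype.val (hsc.2 ⟨w, hwv⟩ hw)
  have hsc' : ∀ w, w ≠ v → G.Adj s w → w = c :=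
    fun w hw h => congrArg Subtype.val (hsc.2 ⟨w, hw⟩ h)
  have e : ∀ {x y : ({v}ᶜ : Set V)}, x ≠ y → (x : V) ≠ y := fun h => Subtype.coe_injective.ne h
  have thin := fun m hm => thin_spider h (ht.induce _) hsc (m := m) hm
  have path : ∀ m, ¬ CAdj (G.induce {v}ᶜ) c m → ∀ x, PendantAt (G.induce {v}ᶜ) m x →
      G.Adj c x → IsPath4 G s c x m := by
    intro m hm x hmx hcx
    have hms : m ≠ s := by
      rintro rfl
      exact hm (.inr hsc.1.symm)
    have hxs : s ≠ x := by
      rintro rfl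
      exact hm (.inl (hsc.2 _ hmx.1.symm).symm)
    refine ⟨hsc.1, hcx, hmx.1.symm, fun h => hcx.ne (hsc' _ x.2 h).symm, fun h => hm (.inr h),
      fun h => hm (.inl (hsc.2 m h).symm), e hxs, e fun h => hm (.inl h), (e hms).symm⟩
  have all : ∀ m, ¬ CAdj (G.induce {v}ᶜ) c m → ∀ x, PendantAt (G.induce {v}ᶜ) m x →
      G.Adj c x → G.Adj v c ∧ G.Adj v x ∧ G.Adj v m := by
    intro m hm x hmx hcx
    rcases ht _ _ _ _ v (path m hm x hmx hcx) (Ne.symm s.2) (Ne.symm c.2) (Ne.symm x.2)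
      (Ne.symm m.2) with h | h | h
    · exact h.2
    · exact (h.1 hvs).elim
    · exact (h.1 hvs).elim
  obtain ⟨m, hm⟩ := exists_not_cAdj h' hsc.1.ne.symm
  obtain ⟨x, hmx, hcx, hx, -⟩ := thin m hm
  have hp := path m hm x hmx hcx
  have hv := all m hm x hmx hcx
  have missed : ∀ r, r ≠ v → ¬ G.Adj v r → r ≠ s ∧ r ≠ x ∧ G.Adj x r ∧ ¬ G.Adj s r := by
    intro r hrv hvr
    have hrs : r ≠ s := by
      rintro rfl
      exact hvr hvs
    have hrx : r ≠ x := by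
      rintro rfl
      exact hvr hv.2.1
    have hrc : r ≠ c := by
      rintro rfl
      exact hvr hv.1
    have hcr : G.Adj c r := by
      by_contra hcr
      have hm : ¬ CAdj (G.induce {v}ᶜ) c ⟨r, hrv⟩ := fun h =>
        h.elim (fun h => hrc (congrArg Subtype.val h).symm) hcr
      obtain ⟨x, hmx, hcx, -⟩ := thin _ hm
      exact hvr (all _ hm x hmx hcx).2.2
    exact ⟨hrs, hrx, hx ⟨r, hrv⟩ (fun h => hrx (congrArg Subtype.val h))
      (fun h => hrs (congrArg Subtype.val h)) hcr, fun h => hrc (hsc' r hrv h)⟩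
  obtain ⟨r, hr⟩ := exists_adj_of_connected hc (Ne.symm s.2)
  refine .inr ⟨v, r, hr, fun r' hr' => ?_⟩
  rw [SimpleGraph.compl_adj] at hr hr'
  obtain ⟨h1, h2, h3, h4⟩ := missed r hr.1.symm hr.2
  obtain ⟨h1', h2', h3', h4'⟩ := missed r' hr'.1.symm hr'.2
  by_contra hrr
  -- A second non-neighbour `r'` of `v` would see the midpoint `x` of this path but not the midpoint
  -- `v`.
  have hp' : IsPath4 G s v x r :=
    ⟨hvs.symm, hv.2.1, h3, hp.ac, hr.2, h4, hp.nac, hr.1, h1.symm⟩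
  rcases ht _ _ _ _ r' hp' h1' hr'.1.symm h2' hrr with h | h | h
  · exact hr'.2 h.2.1.symm
  · exact h.2.2.1 h3'.symm
  · exact hr'.2 h.2.1.symm

/-- A connected `P₄`-sparse graph with connected complement on at least two vertices has a pendant
vertex, or its complement has one. -/
theorem exists_pendant {V : Type*} [Finite V] {G : SimpleGraph V} (ht : Typed G)
    (hG : G.Connected) (hc : Gᶜ.Connected) {a b : V} (hab : a ≠ b) :
    (∃ s, Pendant G s) ∨ ∃ s, Pendant Gᶜ s := by
  obtain ⟨n, hn⟩ : ∃ n, Nat.card V = n := ⟨_, rfl⟩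
  induction n generalizing V with
  | zero =>
    have : Nonempty V := ⟨a⟩
    exact (Nat.card_pos.ne' hn).elim
  | succ n ih =>
    have hcc : Gᶜᶜ.Connected := by rwa [compl_compl]
    by_cases h : (G.induce {a}ᶜ).Connected
    swap
    · exact .inl (exists_pendant_of_not_connected hG hc ht hab h)
    by_cases h' : (Gᶜ.induce {a}ᶜ).Connected
    swap
    · exact .inr (exists_pendant_of_not_connected hc hcc ht.compl hab h')
    obtain ⟨y, hy⟩ := exists_adj_of_connected hG hab
    obtain ⟨z, hz⟩ := exists_adj_of_connected hc hab
    -- A neighbour and a non-neighbour of `a` are two distinct vertices that survive the deletion,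
    -- as the induction hypothesis demands.
    have hyz : y ≠ z := by
      rintro rfl
      exact ((SimpleGraph.compl_adj _ _ _).1 hz).2 hy
    have hcard : Nat.card ({a}ᶜ : Set V) = n := by
      have := Set.ncard_compl ({a} : Set V)
      rw [Set.ncard_singleton, hn] at this
      simpa using this
    rw [← compl_induce] at h'
    rcases ih (ht.induce {a}ᶜ) h h' (a := ⟨y, hy.ne.symm⟩) (b := ⟨z, hz.ne.symm⟩)
      (fun h => hyz (congrArg Subtype.val h)) hcard with hs | hs
    · exact exists_pendant_of_induce ht hc h h' hs
    · have := exists_pendant_of_induce (v := a) ht.compl hcc (compl_induce (G := G) _ ▸ h')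
        (by rwa [← compl_induce, compl_compl]) (compl_induce (G := G) _ ▸ hs)
      rw [compl_compl] at this
      exact this.symm

end Spider

/-! ### Weak Roman domination with few legions -/

section Domination

set_option linter.unusedSectionVars false

variable {V : Type*} [Fintype V] [DecidableEq V] {G : SimpleGraph V}

theorem gammaR_le {f : V → ℕ} (hf : IsWRD G f) {k : ℕ} (hk : ∑ v, f v ≤ k) : gammaR G ≤ k :=
  ((gammaR_spec G).2 ⟨f, hf, rfl⟩).trans hk

theorem exists_isWRD (G : SimpleGraph V) : ∃ f : V → ℕ, IsWRD G f ∧ ∑ v, f v = gammaR G :=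
  (gammaR_spec G).1

theorem not_undefended {f : V → ℕ} {w : V} : ¬ Undefended G f w ↔ ∃ z, CAdj G w z ∧ 0 < f z := by
  constructor
  · intro h
    by_contra! h'
    exact h ⟨Nat.le_zero.1 (h' w (cAdj_refl w)), fun v hv => Nat.le_zero.1 (h' v (.inr hv))⟩
  · rintro ⟨z, rfl | hz, h⟩ ⟨h0, h1⟩
    · omega
    · exact h.ne' (h1 z hz)

/-- Splitting off the moving legion as `Pi.single a 1` removes the truncated subtraction: what
remains is `g` together with the new legion on `u`. All later arguments use functions in this form.
-/
theorem move_pos {g : V → ℕ} {a u z : V} :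
    0 < move (g + Pi.single a 1) a u z ↔ z = u ∨ 0 < g z := by
  unfold move
  split_ifs with h1 h2
  · simp [h1]
  · subst h2
    simp [h1]
  · simp [h1, h2]

theorem exists_token {f : V → ℕ} {a : V} (h : 0 < f a) :
    ∃ g : V → ℕ, f = g + Pi.single a 1 := by
  refine ⟨f - Pi.single a 1, ?_⟩
  ext v
  by_cases hv : v = a
  · subst hv
    simp
    omega
  · simp [hv]

theorem exists_token_of_sum {f : V → ℕ} {k : ℕ} (h : ∑ v, f v = k + 1) :
    ∃ (a : V) (g : V → ℕ), f = g + Pi.single a 1 ∧ ∑ v, g v = k := by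
  obtain ⟨a, -, ha⟩ : ∃ a ∈ Finset.univ, f a ≠ 0 := by
    by_contra! h'
    rw [Finset.sum_eq_zero h'] at h
    omega
  obtain ⟨g, rfl⟩ := exists_token (Nat.pos_of_ne_zero ha)
  refine ⟨a, g, rfl, ?_⟩
  simpa [Finset.sum_add_distrib] using h

theorem eq_zero_of_sum {f : V → ℕ} (h : ∑ v, f v = 0) : f = 0 := by
  ext v
  simpa using (Finset.sum_eq_zero_iff.1 h) v (Finset.mem_univ v)

/-- A vertex of value `0` is defended by removing one unit from a neighbour. -/
theorem IsWRD.defender {f : V → ℕ} (hf : IsWRD G f) {u : V} (hu : f u = 0) :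
    ∃ (v : V) (g : V → ℕ), G.Adj u v ∧ f = g + Pi.single v 1 ∧
      ∀ w, ∃ z, CAdj G w z ∧ (z = u ∨ 0 < g z) := by
  obtain ⟨v, huv, hv, h⟩ := hf.2 u hu
  obtain ⟨g, rfl⟩ := exists_token hv
  refine ⟨v, g, huv, rfl, fun w => ?_⟩
  simpa only [not_undefended, move_pos] using h w

theorem isWRD_iff {f : V → ℕ} : IsWRD G f ↔ (∀ v, f v ≤ 2) ∧ ∀ u, f u = 0 →
    ∃ (v : V) (g : V → ℕ), G.Adj u v ∧ f = g + Pi.single v 1 ∧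
      ∀ w, ∃ z, CAdj G w z ∧ (z = u ∨ 0 < g z) := by
  refine ⟨fun h => ⟨h.1, fun u hu => h.defender hu⟩, fun ⟨h2, h⟩ => ⟨h2, fun u hu => ?_⟩⟩
  obtain ⟨v, g, huv, rfl, hg⟩ := h u hu
  refine ⟨v, huv, by simp, fun w => ?_⟩
  simpa only [not_undefended, move_pos] using hg w

theorem IsWRD.dominates {f : V → ℕ} (hf : IsWRD G f) (w : V) : ∃ z, CAdj G w z ∧ 0 < f z := by
  by_cases hw : f w = 0
  · obtain ⟨v, hwv, hv, -⟩ := hf.2 w hw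
    exact ⟨v, .inr hwv, hv⟩
  · exact ⟨w, cAdj_refl w, Nat.pos_of_ne_zero hw⟩

/-- Every vertex is in the closed neighbourhood of `a` or of `b`. -/
def Dom2 (G : SimpleGraph V) (a b : V) : Prop := ∀ w, CAdj G a w ∨ CAdj G b w

theorem Dom2.symm {a b : V} (h : Dom2 G a b) : Dom2 G b a := fun w => (h w).symm

theorem gammaR_pos [Nonempty V] : 1 ≤ gammaR G := by
  obtain ⟨f, hf, hsum⟩ := exists_isWRD G
  by_contra! h
  obtain rfl := eq_zero_of_sum (hsum.trans (by omega : gammaR G = 0))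
  obtain ⟨z, -, hz⟩ := hf.dominates (Classical.arbitrary V)
  simp at hz

theorem single_pos {a v : V} : 0 < (Pi.single a 1 : V → ℕ) v ↔ v = a := by
  by_cases h : v = a
  · subst h; simp
  · simp [h]

/-- A single legion can be called to any vertex `u`, and from there it must dominate alone; so every
`u` is universal. -/
theorem gammaR_le_one_iff [Nonempty V] : gammaR G ≤ 1 ↔ ∀ a b, CAdj G a b := by
  constructor
  · intro h
    obtain ⟨f, hf, hsum⟩ := exists_isWRD G
    have h1 : ∑ v, f v = 0 + 1 := hsum.trans (le_antisymm h gammaR_pos)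
    obtain ⟨a, g, rfl, hg⟩ := exists_token_of_sum h1
    obtain rfl := eq_zero_of_sum hg
    simp only [zero_add] at hf
    have ha : ∀ w, CAdj G w a := by
      intro w
      obtain ⟨z, hz, hz'⟩ := hf.dominates w
      rw [single_pos] at hz'
      exact hz' ▸ hz
    intro u w
    by_cases hu : u = a
    · exact hu ▸ (ha w).symm
    obtain ⟨v, g, -, hg, h⟩ := hf.defender (u := u) (by simp [hu])
    obtain rfl : a = v := by
      by_contra hav
      have := congrFun hg v
      simp [Ne.symm hav] at this
    obtain rfl : g = 0 := by
      have := congrArg (fun f => f - Pi.single a 1) hg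
      simpa using this.symm
    obtain ⟨z, hz, hz'⟩ := h w
    obtain rfl : z = u := by simpa using hz'
    exact hz.symm
  · intro h
    obtain ⟨a⟩ := ‹Nonempty V›
    refine gammaR_le (f := Pi.single a 1) (isWRD_iff.2 ⟨fun v => ?_, fun u hu => ?_⟩) (by simp)
    · by_cases hv : v = a
      · subst hv; simp
      · simp [hv]
    · have hua : u ≠ a := by
        rintro rfl
        simp at hu
      exact ⟨a, 0, (h u a).adj hua, by simp, fun w => ⟨u, h w u, .inl rfl⟩⟩

/-- One unit on `a` and one on `b` form a weak Roman dominating function. -/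
def SecurePair (G : SimpleGraph V) (a b : V) : Prop :=
  Dom2 G a b ∧ ∀ u, u = a ∨ u = b ∨ (G.Adj u a ∧ Dom2 G u b) ∨ (G.Adj u b ∧ Dom2 G u a)

theorem SecurePair.gammaR_le {a b : V} (h : SecurePair G a b) : gammaR G ≤ 2 := by
  refine WeakRoman.gammaR_le (f := Pi.single a 1 + Pi.single b 1)
    (isWRD_iff.2 ⟨fun v => ?_, fun u hu => ?_⟩) (by simp [Finset.sum_add_distrib])
  · simp only [Pi.add_apply, Pi.single_apply]
    split_ifs <;> simp
  · have hua : u ≠ a := by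
      rintro rfl
      simp at hu
    have hub : u ≠ b := by
      rintro rfl
      simp at hu
    rcases ((h.2 u).resolve_left hua).resolve_left hub with ⟨h1, h2⟩ | ⟨h1, h2⟩
    · refine ⟨a, Pi.single b 1, h1, add_comm _ _, fun w => ?_⟩
      rcases h2 w with h | h
      · exact ⟨u, h.symm, .inl rfl⟩
      · exact ⟨b, h.symm, .inr (by simp)⟩
    · refine ⟨b, Pi.single a 1, h1, rfl, fun w => ?_⟩
      rcases h2 w with h | h
      · exact ⟨u, h.symm, .inl rfl⟩
      · exact ⟨a, h.symm, .inr (by simp)⟩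

/-- A pair may have equal entries, which stands for two legions on one vertex: one answers the call
and the other keeps dominating. -/
theorem securePair_of_universal {a : V} (h : ∀ w, CAdj G a w) : SecurePair G a a := by
  refine ⟨fun w => .inl (h w), fun u => ?_⟩
  rcases h u with rfl | h'
  · exact .inl rfl
  · exact .inr (.inr (.inl ⟨h'.symm, fun w => .inr (h w)⟩))

theorem gammaR_le_two_iff [Nonempty V] : gammaR G ≤ 2 ↔ ∃ a b, SecurePair G a b := by
  refine ⟨fun h => ?_, fun ⟨a, b, h⟩ => h.gammaR_le⟩
  by_cases h1 : gammaR G ≤ 1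
  · obtain ⟨a⟩ := ‹Nonempty V›
    exact ⟨a, a, securePair_of_universal (gammaR_le_one_iff.1 h1 a)⟩
  obtain ⟨f, hf, hsum⟩ := exists_isWRD G
  obtain ⟨a, g, rfl, hg⟩ := exists_token_of_sum (hsum.trans (by omega : gammaR G = 1 + 1))
  obtain ⟨b, g, rfl, hg'⟩ := exists_token_of_sum (hg.trans (zero_add 1).symm)
  obtain rfl := eq_zero_of_sum hg'
  rw [zero_add] at hf
  refine ⟨a, b, fun w => ?_, fun u => ?_⟩
  · obtain ⟨z, hz, hz'⟩ := hf.dominates w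
    rw [Pi.add_apply, add_pos_iff, single_pos, single_pos] at hz'
    rcases hz' with rfl | rfl
    exacts [.inr hz.symm, .inl hz.symm]
  · by_cases hua : u = a
    · exact .inl hua
    by_cases hub : u = b
    · exact .inr (.inl hub)
    refine .inr (.inr ?_)
    obtain ⟨v, g, huv, hg, h⟩ := hf.defender (u := u) (by simp [hua, hub])
    have hv : v = b ∨ v = a := by
      have := congrFun hg v
      rw [← single_pos, ← single_pos (a := a), ← add_pos_iff, ← Pi.add_apply, this]
      simp
    rcases hv with rfl | rfl
    · rw [add_comm] at hg
      obtain rfl := add_right_cancel hg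
      refine .inr ⟨huv, fun w => ?_⟩
      obtain ⟨z, hz, hz'⟩ := h w
      rw [single_pos] at hz'
      rcases hz' with rfl | rfl
      exacts [.inl hz.symm, .inr hz.symm]
    · obtain rfl := add_right_cancel hg
      refine .inl ⟨huv, fun w => ?_⟩
      obtain ⟨z, hz, hz'⟩ := h w
      rw [single_pos] at hz'
      rcases hz' with rfl | rfl
      exacts [.inl hz.symm, .inr hz.symm]

/-- A dominating pair gives a weak Roman dominating function of weight four. -/
theorem Dom2.gammaR_le {a b : V} (h : Dom2 G a b) : gammaR G ≤ 4 := by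
  by_cases hab : a = b
  · subst hab
    exact (securePair_of_universal fun w => (h w).elim id id).gammaR_le.trans (by norm_num)
  refine WeakRoman.gammaR_le
    (f := Pi.single a 1 + Pi.single b 1 + (Pi.single a 1 + Pi.single b 1))
    (isWRD_iff.2 ⟨fun v => ?_, fun u hu => ?_⟩) (by simp [Finset.sum_add_distrib])
  · simp only [Pi.add_apply, Pi.single_apply]
    split_ifs with h1 h2 <;> simp
    exact hab (h1.symm.trans h2)
  · have hua : u ≠ a := by
      rintro rfl
      simp at hu
    have hub : u ≠ b := by
      rintro rfl
      simp at hu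
    have dom : ∀ w : V, ∃ z, CAdj G w z ∧
        0 < (Pi.single a 1 + Pi.single b 1 : V → ℕ) z := by
      intro w
      rcases h w with h | h
      · exact ⟨a, h.symm, by simp⟩
      · exact ⟨b, h.symm, by simp⟩
    have dom' : ∀ (e : V → ℕ) (w : V), ∃ z, CAdj G w z ∧ (z = u ∨
        0 < (Pi.single a 1 + Pi.single b 1 + e : V → ℕ) z) := by
      intro e w
      obtain ⟨z, hz, hz'⟩ := dom w
      exact ⟨z, hz, .inr (Nat.lt_of_lt_of_le hz' (Nat.le_add_right _ _))⟩
    rcases h u with h | h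
    · exact ⟨a, _, h.symm.adj hua, by abel, dom' (Pi.single b 1)⟩
    · exact ⟨b, _, h.symm.adj hub, (add_assoc _ _ _).symm, dom' (Pi.single a 1)⟩

/-- The set of the vertices dominated neither by `a` nor by `b`. -/
def Missed (G : SimpleGraph V) (a b : V) : Set V := {u | ¬ CAdj G a u ∧ ¬ CAdj G b u}

/-- The sets `{a, c}` and `{b, c}` are dominating, and the vertices missed by `a` and `b` form a
clique. -/
def CliqueTriple (G : SimpleGraph V) (a b c : V) : Prop :=
  Dom2 G a c ∧ Dom2 G b c ∧ ∀ u ∈ Missed G a b, ∀ v ∈ Missed G a b, CAdj G u v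

/-- One legion on each vertex. A call from near `a` is answered by `a`, since `b` and `c` still
dominate; likewise for `b`. A vertex missed by both is served by `c`, and then covers the other
missed vertices because they form a clique. -/
theorem CliqueTriple.gammaR_le {a b c : V} (h : CliqueTriple G a b c) : gammaR G ≤ 3 := by
  -- If all three vertices coincide, the weight would be three at one vertex, which is not allowed;
  -- but then that vertex is universal.
  obtain ⟨hac, hbc, hU⟩ := h
  by_cases habc : a = b ∧ a = c
  · obtain ⟨rfl, rfl⟩ := habc
    exact (securePair_of_universal fun w => (hac w).elim id id).gammaR_le.trans (by norm_num)
  refine WeakRoman.gammaR_le (f := Pi.single a 1 + Pi.single b 1 + Pi.single c 1)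
    (isWRD_iff.2 ⟨fun v => ?_, fun u hu => ?_⟩) (by simp [Finset.sum_add_distrib])
  · simp only [Pi.add_apply, Pi.single_apply]
    split_ifs with h1 h2 h3 <;> simp
    exact habc ⟨h1.symm.trans h2, h1.symm.trans h3⟩
  · have hua : u ≠ a := by
      rintro rfl
      simp at hu
    have hub : u ≠ b := by
      rintro rfl
      simp at hu
    have huc : u ≠ c := by
      rintro rfl
      simp at hu
    by_cases ha : CAdj G a u
    · refine ⟨a, Pi.single b 1 + Pi.single c 1, ha.symm.adj hua, by abel, fun w => ?_⟩
      rcases hbc w with h | h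
      · exact ⟨b, h.symm, .inr (by simp)⟩
      · exact ⟨c, h.symm, .inr (by simp)⟩
    by_cases hb : CAdj G b u
    · refine ⟨b, Pi.single a 1 + Pi.single c 1, hb.symm.adj hub, by abel, fun w => ?_⟩
      rcases hac w with h | h
      · exact ⟨a, h.symm, .inr (by simp)⟩
      · exact ⟨c, h.symm, .inr (by simp)⟩
    refine ⟨c, _, ((hac u).resolve_left ha).symm.adj huc, rfl, fun w => ?_⟩
    by_cases ha' : CAdj G a w
    · exact ⟨a, ha'.symm, .inr (by simp)⟩
    by_cases hb' : CAdj G b w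
    · exact ⟨b, hb'.symm, .inr (by simp)⟩
    exact ⟨u, hU w ⟨ha', hb'⟩ u ⟨ha, hb⟩, .inl rfl⟩

/-- The vertices missed by two of the three units of a weak Roman dominating function of weight
three form a clique. -/
theorem IsWRD.cAdj_of_missed {a b c : V}
    (hf : IsWRD G (Pi.single a 1 + Pi.single b 1 + Pi.single c 1)) {u v : V}
    (hu : u ∈ Missed G a b) (hv : v ∈ Missed G a b) : CAdj G u v := by
  have key : ∀ u, u ∈ Missed G a b → u ≠ c → G.Adj u c ∧
      ∀ w, w ∈ Missed G a b → CAdj G w u := by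
    intro u hu huc
    have hua : u ≠ a := by
      rintro rfl
      exact hu.1 (cAdj_refl _)
    have hub : u ≠ b := by
      rintro rfl
      exact hu.2 (cAdj_refl _)
    obtain ⟨v, g, huv, hg, h⟩ := hf.defender (u := u) (by simp [hua, hub, huc])
    have hv : (v = a ∨ v = b) ∨ v = c := by
      have := congrFun hg v
      rw [← single_pos, ← single_pos (a := b), ← single_pos (a := c), ← add_pos_iff,
        ← Pi.add_apply, ← add_pos_iff, ← Pi.add_apply, this]
      simp
    rcases hv with (rfl | rfl) | rfl
    · exact (hu.1 (.inr huv.symm)).elim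
    · exact (hu.2 (.inr huv.symm)).elim
    obtain rfl := add_right_cancel hg
    refine ⟨huv, fun w hw => ?_⟩
    obtain ⟨z, hz, hz'⟩ := h w
    rw [Pi.add_apply, add_pos_iff, single_pos, single_pos] at hz'
    rcases hz' with rfl | rfl | rfl
    · exact hz
    · exact (hw.1 hz.symm).elim
    · exact (hw.2 hz.symm).elim
  by_cases huc : u = c
  · by_cases hvc : v = c
    · exact .inl (huc.trans hvc.symm)
    · subst huc
      exact .inr (key v hv hvc).1.symm
  · exact ((key u hu huc).2 v hv).symm

/-- In a `P₄`-sparse graph a clique triple can be chosen such that the missed vertices are true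
twins. -/
theorem CliqueTriple.exists_twins (ht : Typed G) {a b c : V} (h : CliqueTriple G a b c) :
    ∃ a b, Dom2 G a c ∧ Dom2 G b c ∧
      ∀ u ∈ Missed G a b, ∀ v ∈ Missed G a b, ∀ x, CAdj G u x ↔ CAdj G v x := by
  -- Descent on the number of missed vertices, with `c` fixed.
  obtain ⟨k, hk⟩ : ∃ k, (Missed G a b).ncard = k := ⟨_, rfl⟩
  induction k using Nat.strong_induction_on generalizing a b with
  | _ k ih =>
  obtain ⟨hac, hbc, hU⟩ := h
  by_contra! hno
  obtain ⟨u, hu, v, hv, x, hx⟩ := hno a b hac hbc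
  obtain ⟨u, hu, v, hv, hux, hvx⟩ : ∃ u ∈ Missed G a b, ∃ v ∈ Missed G a b,
      CAdj G u x ∧ ¬ CAdj G v x := by
    rcases hx with ⟨h1, h2⟩ | ⟨h1, h2⟩
    exacts [⟨u, hu, v, hv, h1, h2⟩, ⟨v, hv, u, hu, h2, h1⟩]
  have huv := hU u hu v hv
  have hne : u ≠ v := by
    rintro rfl
    exact hvx hux
  have hxu : u ≠ x := by
    rintro rfl
    exact hvx huv.symm
  have hxU : x ∉ Missed G a b := fun hx => hvx (hU v hv x hx)
  -- Here `x` separates the missed vertices `u` and `v`, and `a, x, u, v` is an induced path. A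
  -- neighbour of the end `a` off this path sees all of it, so the closed neighbourhood of `a` is
  -- contained in that of `x`. Replacing `a` by `x` keeps domination and additionally covers `u`.
  have replace_left : ∀ a b, u ∈ Missed G a b → v ∈ Missed G a b → CAdj G a x →
      ∀ y, CAdj G a y → CAdj G x y := by
    intro a b hu hv hax y hay
    have hxa : a ≠ x := by
      rintro rfl
      exact hu.1 hux.symm
    by_cases hya : y = a
    · exact hya ▸ hax.symm
    by_cases hyx : y = x
    · exact .inl hyx.symm
    have hyu : y ≠ u := by
      rintro rfl
      exact hu.1 hay
    have hyv : y ≠ v := by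
      rintro rfl
      exact hv.1 hay
    have hp : IsPath4 G a x u v :=
      ⟨hax.adj hxa, (hux.adj hxu).symm, huv.adj hne, fun h => hu.1 (.inr h),
        fun h => hvx (.inr h.symm), fun h => hv.1 (.inr h), fun h => hu.1 (.inl h),
        fun h => hvx (.inl h.symm), fun h => hv.1 (.inl h)⟩
    have hay' : G.Adj y a := (hay.adj (Ne.symm hya)).symm
    rcases ht _ _ _ _ y hp hya hyx hyu hyv with h | h | h
    · exact .inr h.2.1.symm
    · exact (h.1 hay').elim
    · exact (h.1 hay').elim
  have smaller : ∀ a' b', (∀ y, CAdj G a y ∨ CAdj G b y → CAdj G a' y ∨ CAdj G b' y) →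
      (CAdj G a' u ∨ CAdj G b' u) → Dom2 G a' c → Dom2 G b' c → False := by
    intro a' b' hsub hu' ha' hb'
    have hss : Missed G a' b' ⊂ Missed G a b := by
      refine ⟨fun y hy => ?_, fun h => ?_⟩
      · by_contra hy'
        simp only [Missed, Set.mem_ofPred_eq, not_and_or, not_not] at hy'
        exact (hsub y hy').elim hy.1 hy.2
      · exact hu'.elim (h hu).1 (h hu).2
    obtain ⟨p, q, hp, hq, hpq⟩ := ih _ (hk ▸ Set.ncard_lt_ncard hss)
      ⟨ha', hb', fun u hu v hv => hU u (hss.1 hu) v (hss.1 hv)⟩ rfl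
    obtain ⟨u, hu, v, hv, y, hy⟩ := hno p q hp hq
    have := hpq u hu v hv y
    tauto
  simp only [Missed, Set.mem_ofPred_eq, not_and_or, not_not] at hxU
  rcases hxU with hx | hx
  · have hsub := replace_left a b hu hv hx
    exact smaller x b (fun y hy => hy.imp_left (hsub y)) (.inl hux.symm)
      (fun w => (hac w).imp_left (hsub w)) hbc
  · have hsub := replace_left b a hu.symm hv.symm hx
    exact smaller a x (fun y hy => hy.imp_right (hsub y)) (.inr hux.symm) hac
      (fun w => (hbc w).imp_left (hsub w))

end Domination

/-! ### The value for connected `P₄`-sparse graphs -/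

section Value

set_option linter.unusedSectionVars false

variable {V : Type*} [Fintype V] [DecidableEq V] {G : SimpleGraph V}

theorem PendantAt.eq {s c d : V} (h : PendantAt G s c) (h' : PendantAt G s d) : c = d :=
  h'.2 c h.1

/-- The weak Roman domination number of a thin spider with `k` legs is `k`, or `k + 1` if the head
is nonempty. -/
theorem gammaR_eq_of_pendant (hG : G.Connected) (ht : Typed G) (huniv : ∀ c, ∃ m, ¬ CAdj G c m)
    (hp : ∃ s, Pendant G s) : gammaR G = {s | Pendant G s}.ncard +
      if Fintype.card V = 2 * {s | Pendant G s}.ncard then 0 else 1 := by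
  classical
  set S : Finset V := Finset.univ.filter (Pendant G) with hS
  have hL : {s | Pendant G s}.ncard = S.card := by
    rw [← Set.ncard_coe_finset]
    congr 1
    ext
    simp [hS]
  have memS : ∀ s, s ∈ S ↔ Pendant G s := by simp [hS]
  rw [hL]
  have : ∀ p, ∃ c, Pendant G p → PendantAt G p c := fun p =>
    if h : Pendant G p then ⟨h.choose, fun _ => h.choose_spec⟩ else ⟨p, fun h' => (h h').elim⟩
  choose nb hnb using this
  simp only [← memS] at hnb
  -- `S` is the set of legs and `K`, below, the set of feet; the head is the rest.
  have foot : ∀ s c v, PendantAt G s c → v ∉ S → CAdj G c v := by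
    intro s c v hs hv
    by_contra h
    obtain ⟨x, hx, -⟩ := thin_spider hG ht hs h
    exact hv ((memS v).2 ⟨x, hx⟩)
  have other : ∀ s c, PendantAt G s c → ∃ m x, PendantAt G m x ∧ G.Adj c x ∧ x ≠ s ∧ m ≠ s ∧
      x ≠ c ∧ ∀ y, y ≠ x → y ≠ s → G.Adj c y → G.Adj x y := by
    intro s c hs
    obtain ⟨m, hm⟩ := huniv c
    obtain ⟨x, hmx, hcx, hx, -⟩ := thin_spider hG ht hs hm
    refine ⟨m, x, hmx, hcx, ?_, ?_, hcx.ne.symm, hx⟩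
    · rintro rfl
      exact hm (.inl (hs.2 m hmx.1.symm).symm)
    · rintro rfl
      exact hm (.inr hs.1.symm)
  have nbS : ∀ p ∈ S, nb p ∉ S := by
    intro p hp h
    obtain ⟨m, x, -, hcx, hxs, -⟩ := other p _ (hnb p hp)
    have h' := hnb _ h
    exact hxs ((h'.2 x hcx).trans (h'.2 p (hnb p hp).1.symm).symm)
  have inj : ∀ p ∈ S, ∀ q ∈ S, nb p = nb q → p = q := by
    intro p hp q hq hpq
    by_contra hne
    obtain ⟨m, x, hmx, hcx, hxs, -, hxc, hx⟩ := other p _ (hnb p hp)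
    have hq' := hnb q hq
    rw [← hpq] at hq'
    have hqx : q ≠ x := by
      rintro rfl
      have hm : m = nb p := hq'.2 m hmx.1.symm
      have hpq : p = q := hmx.2 p (hm ▸ (hnb p hp).1.symm)
      exact hne hpq
    exact hxc (hq'.2 x (hx q hqx (Ne.symm hne) hq'.1.symm).symm)
  set K : Finset V := S.image nb with hK
  have hKcard : K.card = S.card := Finset.card_image_of_injOn fun p hp q hq => inj p hp q hq
  have disj : Disjoint S K := by
    rw [Finset.disjoint_right]
    intro c hc
    obtain ⟨p, hp, rfl⟩ := Finset.mem_image.1 hc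
    exact nbS p hp
  have memK : ∀ p ∈ S, nb p ∈ K := fun p hp => Finset.mem_image_of_mem _ hp
  have hcard : (S ∪ K).card = 2 * S.card := by
    rw [Finset.card_union_of_disjoint disj, hKcard, two_mul]
  have hdom : ∀ f : V → ℕ, IsWRD G f → ∀ p ∈ S, 1 ≤ f p + f (nb p) := by
    intro f hf p hp
    obtain ⟨z, rfl | hz, hz'⟩ := hf.dominates p
    · omega
    · rw [(hnb p hp).2 z hz] at hz'
      omega
  have hsumSK : ∀ f : V → ℕ, ∑ v ∈ S ∪ K, f v = ∑ p ∈ S, (f p + f (nb p)) := by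
    intro f
    rw [Finset.sum_union disj, hK, Finset.sum_image fun p hp q hq => inj p hp q hq,
      Finset.sum_add_distrib]
  have hSone : S.card = ∑ p ∈ S, 1 := by simp
  have lower : S.card ≤ gammaR G := by
    obtain ⟨f, hf, hsum⟩ := exists_isWRD G
    rw [← hsum, hSone]
    calc ∑ p ∈ S, 1 ≤ ∑ p ∈ S, (f p + f (nb p)) := Finset.sum_le_sum (hdom f hf)
      _ = ∑ v ∈ S ∪ K, f v := (hsumSK f).symm
      _ ≤ ∑ v, f v := Finset.sum_le_sum_of_subset (Finset.subset_univ _)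
  obtain ⟨s₀, hs₀⟩ := hp
  rw [← memS] at hs₀
  split_ifs with hn
  · have huniv : S ∪ K = Finset.univ := by
      rw [← Finset.card_eq_iff_eq_univ, hcard, hn]
    refine le_antisymm ?_ lower
    -- Without a head, one legion on each leg suffices: a leg steps onto its foot, which covers that
    -- leg and all feet.
    refine gammaR_le (f := fun v => if v ∈ S then 1 else 0)
      (isWRD_iff.2 ⟨fun v => ?_, fun u hu => ?_⟩) (by simp)
    · split_ifs <;> simp
    · have hu : u ∉ S := by simpa using hu
      have huK : u ∈ K := by
        have := Finset.mem_univ u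
        rw [← huniv, Finset.mem_union] at this
        exact this.resolve_left hu
      obtain ⟨s, hs, rfl⟩ := Finset.mem_image.1 huK
      obtain ⟨g, hg⟩ := exists_token (f := fun v => if v ∈ S then 1 else 0) (a := s) (by simp [hs])
      refine ⟨s, g, (hnb s hs).1.symm, hg, fun w => ?_⟩
      by_cases hw : w ∈ S
      · by_cases hws : w = s
        · subst hws
          exact ⟨nb w, .inr (hnb w hs).1, .inl rfl⟩
        · refine ⟨w, cAdj_refl w, .inr ?_⟩
          have := congrFun hg w
          simp [hw, hws] at this
          omega
      · exact ⟨nb s, (foot s _ w (hnb s hs) hw).symm, .inl rfl⟩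
  · have huniv : S ∪ K ≠ Finset.univ := by
      rwa [Ne, ← Finset.card_eq_iff_eq_univ, hcard, eq_comm]
    obtain ⟨r, hr⟩ : ∃ r, r ∉ S ∪ K := by
      by_contra! h
      exact huniv (Finset.eq_univ_iff_forall.2 h)
    have hrS : r ∉ S := fun h => hr (Finset.mem_union_left _ h)
    have hrK : r ∉ K := fun h => hr (Finset.mem_union_right _ h)
    refine le_antisymm ?_ (lower.lt_of_ne ?_)
    · set c₀ := nb s₀
      -- With a head, all feet carry one legion and `c₀` carries a spare. The spare answers calls
      -- from the head. A call from a leg is answered by its own foot, and another foot still covers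
      -- everything except legs.
      refine gammaR_le (f := (fun v => if v ∈ K then 1 else 0) + Pi.single c₀ 1)
        (isWRD_iff.2 ⟨fun v => ?_, fun u hu => ?_⟩)
        (by simp [Finset.sum_add_distrib, hKcard])
      · simp only [Pi.add_apply, Pi.single_apply]
        split_ifs <;> simp
      · have huK : u ∉ K := by
          intro h
          simp [h] at hu
        by_cases huS : u ∈ S
        · obtain ⟨g, hg⟩ := exists_token
            (f := (fun v => if v ∈ K then 1 else 0) + Pi.single c₀ 1) (a := nb u)
            (by simp [memK u huS])
          have hgpos : ∀ c ∈ K, c ≠ nb u → 0 < g c := by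
            intro c hc hcu
            have := congrFun hg c
            simp [hc, hcu] at this
            omega
          refine ⟨nb u, g, (hnb u huS).1, hg, fun w => ?_⟩
          by_cases hw : w ∈ S
          · by_cases hwu : w = u
            · exact ⟨u, .inl hwu, .inl rfl⟩
            · exact ⟨nb w, .inr (hnb w hw).1, .inr (hgpos _ (memK w hw) fun h =>
                hwu (inj w hw u huS h))⟩
          · obtain ⟨m, x, hmx, hcx, -⟩ := other u _ (hnb u huS)
            have hm : m ∈ S := (memS m).2 ⟨x, hmx⟩
            have hx : nb m = x := (hnb m hm).eq hmx
            refine ⟨x, (foot m x w hmx hw).symm, .inr (hgpos _ (hx ▸ memK m hm) hcx.ne.symm)⟩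
        · refine ⟨c₀, _, ?_, rfl, fun w => ?_⟩
          · refine (foot s₀ c₀ u (hnb s₀ hs₀) huS).symm.adj ?_
            rintro rfl
            exact huK (memK s₀ hs₀)
          · by_cases hw : w ∈ S
            · exact ⟨nb w, .inr (hnb w hw).1, .inr (by simp [memK w hw])⟩
            · exact ⟨c₀, (foot s₀ c₀ w (hnb s₀ hs₀) hw).symm, .inr (by
                have : c₀ ∈ K := memK s₀ hs₀
                simp [this])⟩
    -- If the number of legs were enough, each leg-foot pair would carry exactly one legion and the
    -- head none. The defender of `r` is then a foot, and its departure leaves its own leg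
    -- undefended.
    · intro hlow
      obtain ⟨f, hf, hsum⟩ := exists_isWRD G
      have hle : ∑ v ∈ S ∪ K, f v ≤ S.card := by
        rw [hlow, ← hsum]
        exact Finset.sum_le_sum_of_subset (Finset.subset_univ _)
      have hge : S.card ≤ ∑ v ∈ S ∪ K, f v := by
        rw [hSone, hsumSK]
        exact Finset.sum_le_sum (hdom f hf)
      have hone : ∀ p ∈ S, 1 = f p + f (nb p) := by
        refine (Finset.sum_eq_sum_iff_of_le (hdom f hf)).1 ?_
        rw [← hsumSK, ← hSone]
        exact le_antisymm hge hle
      have hout : ∀ z, z ∉ S ∪ K → f z = 0 := by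
        intro z hz
        have := Finset.sum_le_sum_of_subset (f := f) (Finset.subset_univ (insert z (S ∪ K)))
        rw [Finset.sum_insert hz, hsum, ← hlow] at this
        omega
      obtain ⟨v, hrv, hv, h⟩ := hf.2 r (hout r hr)
      have hvSK : v ∈ S ∪ K := by
        by_contra hv'
        exact hv.ne' (hout v hv')
      rcases Finset.mem_union.1 hvSK with hvS | hvK
      · refine hrK ?_
        rw [(hnb v hvS).2 r hrv.symm]
        exact memK v hvS
      · obtain ⟨p, hp, rfl⟩ := Finset.mem_image.1 hvK
        have h1 := hone p hp
        have hpr : p ≠ r := fun h => hrS (h ▸ hp)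
        refine h p ⟨?_, fun w hw => ?_⟩
        · have : p ≠ nb p := (hnb p hp).1.ne
          simp only [move, hpr, this, if_false]
          omega
        · rw [(hnb p hp).2 w hw]
          simp only [move, hrv.ne.symm, if_false, if_true]
          omega

/-- The two sides of a join. -/
theorem exists_join [Nonempty V] (hc : ¬ Gᶜ.Connected) :
    ∃ p : V → Prop, (∃ a, p a) ∧ (∃ b, ¬ p b) ∧ ∀ x y, p x → ¬ p y → G.Adj x y := by
  obtain ⟨p, ha, hb, hp⟩ := exists_closed_of_not_connected hc
  refine ⟨p, ha, hb, fun x y hx hy => ?_⟩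
  by_contra h
  have hne : x ≠ y := by
    rintro rfl
    exact hy hx
  exact hy ((hp x y ((SimpleGraph.compl_adj _ _ _).2 ⟨hne, h⟩)).1 hx)

theorem dom2_of_join {p : V → Prop} (h : ∀ x y, p x → ¬ p y → G.Adj x y) {a b : V} (ha : p a)
    (hb : ¬ p b) : Dom2 G a b := by
  intro w
  by_cases hw : p w
  · exact .inr (.inr (h w b hw hb).symm)
  · exact .inl (.inr (h a w ha hw))

/-- By pigeonhole two of the three legions lie on one side, and what they miss is a clique by
`IsWRD.cAdj_of_missed`. The third vertex of the triple need not be the third legion: any vertex of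
the other side dominates together with each of the two. -/
theorem cliqueTriple_of_join {p : V → Prop} (ha : ∃ a, p a) (hb : ∃ b, ¬ p b)
    (h : ∀ x y, p x → ¬ p y → G.Adj x y) (h3 : gammaR G = 3) : ∃ a b c, CliqueTriple G a b c := by
  obtain ⟨f, hf, hsum⟩ := exists_isWRD G
  obtain ⟨z, g₁, rfl, h1⟩ := exists_token_of_sum (hsum.trans h3)
  obtain ⟨y, g₂, rfl, h2⟩ := exists_token_of_sum h1
  obtain ⟨x, g₃, rfl, h3⟩ := exists_token_of_sum (h2.trans (zero_add 1).symm)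
  obtain rfl := eq_zero_of_sum h3
  rw [zero_add] at hf
  have key : ∀ x y z : V, IsWRD G (Pi.single x 1 + Pi.single y 1 + Pi.single z 1) → (p x ↔ p y) →
      ∃ a b c, CliqueTriple G a b c := by
    intro x y z hf hxy
    by_cases hx : p x
    · obtain ⟨c, hc⟩ := hb
      exact ⟨x, y, c, dom2_of_join h hx hc, dom2_of_join h (hxy.1 hx) hc,
        fun u hu v hv => hf.cAdj_of_missed hu hv⟩
    · obtain ⟨c, hc⟩ := ha
      exact ⟨x, y, c, (dom2_of_join h hc hx).symm, (dom2_of_join h hc (hxy.not.1 hx)).symm,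
        fun u hu v hv => hf.cAdj_of_missed hu hv⟩
  by_cases hxy : p x ↔ p y
  · exact key x y z hf hxy
  by_cases hxz : p x ↔ p z
  · exact key x z y (by convert hf using 1; abel) hxz
  · exact key y z x (by convert hf using 1; abel) (by tauto)

/-- A thick spider that is not thin has three vertices any two of which form a dominating set. -/
theorem cliqueTriple_of_compl_pendant (hG : G.Connected) (hc : Gᶜ.Connected) (ht : Typed G)
    (hs : ∃ s, Pendant Gᶜ s) (hno : ¬ ∃ s, Pendant G s) : ∃ a b c, CliqueTriple G a b c := by
  obtain ⟨s, c, hs⟩ := hs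
  have hcc : Gᶜᶜ.Connected := by rwa [compl_compl]
  have thin := fun m hm => thin_spider hc ht.compl hs (m := m) hm
  obtain ⟨m, hm⟩ := exists_not_cAdj hcc hs.1.ne.symm
  -- If `m` were the only such vertex, it would be the only neighbour of `c` in `G`, making `c`
  -- pendant.
  obtain ⟨m', hm', hmm⟩ : ∃ m', ¬ CAdj Gᶜ c m' ∧ m' ≠ m := by
    by_contra! h
    refine hno ⟨c, m, ?_, fun w hw => h w fun hcw => ?_⟩
    · by_contra hcm
      exact hm (.inr ((SimpleGraph.compl_adj _ _ _).2 ⟨fun h => hm (.inl h), hcm⟩))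
    · rcases hcw with rfl | hcw
      · exact G.loopless.irrefl _ hw
      · exact ((SimpleGraph.compl_adj _ _ _).1 hcw).2 hw
  obtain ⟨x, hmx, hcx, -, hx⟩ := thin m hm
  obtain ⟨x', hmx', hcx', -⟩ := thin m' hm'
  -- Two vertices that each have a single non-neighbour, these being distinct, dominate together.
  have dom : ∀ {a b d e : V}, a ≠ b → PendantAt Gᶜ a d → PendantAt Gᶜ b e → d ≠ e →
      Dom2 G a b := by
    intro a b d e hab ha hb hde w
    by_contra! hw
    simp only [CAdj, not_or] at hw
    have h1 := ha.2 w ((SimpleGraph.compl_adj _ _ _).2 hw.1)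
    have h2 := hb.2 w ((SimpleGraph.compl_adj _ _ _).2 hw.2)
    exact hde (h1.symm.trans h2)
  have hms : ∀ m, ¬ CAdj Gᶜ c m → m ≠ s := by
    rintro m hm rfl
    exact hm (.inr hs.1.symm)
  have hxx : x ≠ x' := by
    rintro rfl
    exact hx m' hm' hmm hmx'.1.symm
  have d1 := dom (hms m hm) hmx hs hcx.ne.symm
  have d2 := dom (hms m' hm') hmx' hs hcx'.ne.symm
  have d3 := dom hmm.symm hmx hmx' hxx
  exact ⟨m, m', s, d1, d2, fun u hu => ((d3 u).elim hu.1 hu.2).elim⟩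

/-- The sets `{a, c}` and `{b, c}` are dominating, and the vertices missed by `a` and `b` are true
twins. -/
def TwinTriple (G : SimpleGraph V) (a b c : V) : Prop :=
  Dom2 G a c ∧ Dom2 G b c ∧
    ∀ u ∈ Missed G a b, ∀ v ∈ Missed G a b, ∀ x, CAdj G u x ↔ CAdj G v x

theorem TwinTriple.gammaR_le {a b c : V} (h : TwinTriple G a b c) : gammaR G ≤ 3 :=
  CliqueTriple.gammaR_le (c := c)
    ⟨h.1, h.2.1, fun u hu v hv => (h.2.2 u hu v hv v).2 (cAdj_refl v)⟩

open Classical in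
/-- The weak Roman domination number of a connected `P₄`-sparse graph. -/
theorem gammaR_eq (hG : G.Connected) (ht : Typed G) :
    gammaR G =
      if ∀ a b, CAdj G a b then 1
      else if ∃ a b, SecurePair G a b then 2
      else if 0 < {s | Pendant G s}.ncard then
        {s | Pendant G s}.ncard + if Fintype.card V = 2 * {s | Pendant G s}.ncard then 0 else 1
      else if ∃ a b c, TwinTriple G a b c then 3 else 4 := by
  have := hG.nonempty
  have hpos := gammaR_pos (G := G)
  split_ifs with h1 h2 h3 h4 h5
  · exact le_antisymm (gammaR_le_one_iff.2 h1) hpos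
  · have := gammaR_le_one_iff.not.2 h1
    have := gammaR_le_two_iff.2 h2
    omega
  all_goals
    have huniv : ∀ c, ∃ m, ¬ CAdj G c m := by
      intro c
      by_contra! h
      exact h2 ⟨c, c, securePair_of_universal h⟩
  · rw [gammaR_eq_of_pendant hG ht huniv ((Set.ncard_pos).1 h3), if_pos h4]
  · rw [gammaR_eq_of_pendant hG ht huniv ((Set.ncard_pos).1 h3), if_neg h4]
  all_goals
    have := gammaR_le_two_iff.not.2 h2
  · obtain ⟨a, b, c, h⟩ := h5
    have := h.gammaR_le
    omega
  · have hno : ¬ ∃ s, Pendant G s := fun h => h3 ((Set.ncard_pos).2 h)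
    have hclique : ¬ ∃ a b c, CliqueTriple G a b c := by
      rintro ⟨a, b, c, h⟩
      obtain ⟨a, b, h⟩ := h.exists_twins ht
      exact h5 ⟨a, b, c, h⟩
    by_cases hc : Gᶜ.Connected
    · obtain ⟨m, hm⟩ := huniv (Classical.arbitrary V)
      have hs := (exists_pendant ht hG hc fun h => hm (.inl h)).resolve_left hno
      exact (hclique (cliqueTriple_of_compl_pendant hG hc ht hs hno)).elim
    · obtain ⟨p, ⟨a, ha⟩, ⟨b, hb⟩, hp⟩ := exists_join hc
      have h4 := (dom2_of_join hp ha hb).gammaR_le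
      have : gammaR G ≠ 3 := fun h => hclique (cliqueTriple_of_join ⟨a, ha⟩ ⟨b, hb⟩ hp h)
      omega

end Value

/-! ### Programs that evaluate terms with bounded sums -/

/-- The program `p`, started in `σ`, terminates after at most `T` steps in a store satisfying
`Q`. -/
def Runs (W : ℕ) (p : Program) (σ : Store) (T : ℕ) (Q : Store → Prop) : Prop :=
  ∃ t τ, Exec W p σ t τ ∧ t ≤ T ∧ Q τ

section Runs

variable {W : ℕ} {p q : Program} {σ : Store} {S T : ℕ} {P Q : Store → Prop}

theorem Runs.mono (h : Runs W p σ S P) (hST : S ≤ T) (hPQ : ∀ τ, P τ → Q τ) : Runs W p σ T Q := by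
  obtain ⟨t, τ, h1, h2, h3⟩ := h
  exact ⟨t, τ, h1, h2.trans hST, hPQ τ h3⟩

theorem Runs.seq (hp : Runs W p σ S P) (hq : ∀ τ, P τ → Runs W q τ T Q) :
    Runs W (.seq p q) σ (S + T) Q := by
  obtain ⟨s, τ, h1, h2, h3⟩ := hp
  obtain ⟨t, υ, h4, h5, h6⟩ := hq τ h3
  exact ⟨s + t, υ, .seq h1 h4, add_le_add h2 h5, h6⟩

theorem Runs.setReg {r : ℕ} {x : Expr} (hx : x.Fits W σ) (hQ : Q (σ.setReg r (x.eval σ))) :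
    Runs W (.setReg r x) σ (x.cost + 1) Q :=
  ⟨_, _, .setReg σ r x hx, le_rfl, hQ⟩

theorem Runs.setCell {a : ℕ} {i x : Expr} (hi : i.Fits W σ) (hx : x.Fits W σ)
    (hQ : Q (σ.setCell a (i.eval σ) (x.eval σ))) :
    Runs W (.setCell a i x) σ (i.cost + x.cost + 1) Q :=
  ⟨_, _, .setCell σ a i x hi hx, le_rfl, hQ⟩

/-- `while reg i < reg 0 do p`. -/
def Program.while (i : ℕ) (p : Program) : Program := .loop (.lt (.reg i) (.reg 0)) p

/-- The rule for a loop with counter `i`. -/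
theorem Runs.while {i n : ℕ} {inv : ℕ → Store → Prop} (hW : n < W) (hW1 : 1 < W)
    (hi : ∀ k τ, inv k τ → τ.reg i = k ∧ τ.reg 0 = n)
    (hp : ∀ k τ, k < n → inv k τ → Runs W p τ T (inv (k + 1))) (h0 : inv 0 σ) :
    Runs W (.while i p) σ (n * (T + 4) + 4) (inv n) := by
  have key : ∀ m k τ, m + k = n → inv k τ → Runs W (.while i p) τ (m * (T + 4) + 4) (inv n) := by
    intro m
    induction m with
    | zero =>
      intro k τ hk h
      rw [zero_add] at hk
      subst hk
      obtain ⟨h1, h2⟩ := hi k τ h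
      exact ⟨4, τ, .loopFalse ⟨by simpa [Expr.Fits, h1], by simpa [Expr.Fits, h2], hW1⟩
        (by simp [Expr.eval, h1, h2]), by simp, h⟩
    | succ m ih =>
      intro k τ hk h
      obtain ⟨h1, h2⟩ := hi k τ h
      obtain ⟨s, υ, h3, h4, h5⟩ := hp k τ (by omega) h
      obtain ⟨t, φ, h6, h7, h8⟩ := ih (k + 1) υ (by omega) h5
      refine ⟨4 + s + t, φ, .loopTrue (x := .lt (.reg i) (.reg 0)) ⟨?_, ?_, hW1⟩ ?_ h3 h6, ?_, h8⟩
      · simp only [Expr.Fits, h1]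
        omega
      · simpa only [Expr.Fits, h2]
      · have : k < n := by omega
        simp [Expr.eval, h1, h2, this]
      · rw [add_mul]
        omega
  exact key n 0 σ (add_zero n) h0

end Runs

@[simp] theorem Store.setReg_reg (σ : Store) (i k r : ℕ) :
    (σ.setReg i k).reg r = if r = i then k else σ.reg r := by
  simp [Store.setReg, Function.update_apply]

@[simp] theorem Store.setReg_arr (σ : Store) (i k : ℕ) : (σ.setReg i k).arr = σ.arr := rfl

@[simp] theorem Store.setCell_arr (σ : Store) (a i k b j : ℕ) :
    (σ.setCell a i k).arr b j = if b = a ∧ j = i then k else σ.arr b j := by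
  simp only [Store.setCell, Function.update_apply]
  by_cases hb : b = a
  · subst hb
    simp [Function.update_apply]
  · simp [hb]

/-- Binary operations. -/
inductive Op : Type
  | add | sub | mul | lt | eq

/-- The expression with the given operation. -/
def Op.expr : Op → Expr → Expr → Expr
  | .add => .add
  | .sub => .sub
  | .mul => .mul
  | .lt => .lt
  | .eq => .eq

/-- The function denoted by an operation. -/
def Op.fn : Op → ℕ → ℕ → ℕ
  | .add, x, y => x + y
  | .sub, x, y => x - y
  | .mul, x, y => x * y
  | .lt, x, y => if x < y then 1 else 0
  | .eq, x, y => if x = y then 1 else 0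

theorem Op.eval_expr (o : Op) (σ : Store) (x y : Expr) :
    (o.expr x y).eval σ = o.fn (x.eval σ) (y.eval σ) := by
  cases o <;> rfl

theorem Op.cost_expr (o : Op) (x y : Expr) : (o.expr x y).cost = x.cost + y.cost + 1 := by
  cases o <;> rfl

theorem Op.fits_expr (o : Op) {W : ℕ} {σ : Store} {x y : Expr} (hx : x.Fits W σ)
    (hy : y.Fits W σ) (h : o.fn (x.eval σ) (y.eval σ) < W) (hW : 1 < W) :
    (o.expr x y).Fits W σ := by
  cases o
  exacts [⟨hx, hy, h⟩, ⟨hx, hy⟩, ⟨hx, hy, h⟩, ⟨hx, hy, hW⟩, ⟨hx, hy, hW⟩]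

theorem Op.fn_le (o : Op) {B x y k l : ℕ} (hB : 2 ≤ B) (hx : x ≤ B ^ k) (hy : y ≤ B ^ l) :
    o.fn x y ≤ B ^ (k + l + 1) := by
  have hk : 1 ≤ B ^ k := Nat.one_le_pow _ _ (by omega)
  have hl : 1 ≤ B ^ l := Nat.one_le_pow _ _ (by omega)
  have h1 : 1 ≤ B ^ (k + l + 1) := Nat.one_le_pow _ _ (by omega)
  have h2 : B ^ k * B ^ l * 2 ≤ B ^ (k + l + 1) := by
    rw [pow_succ, pow_add]
    exact Nat.mul_le_mul_left _ hB
  cases o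
  · simp only [Op.fn]
    nlinarith
  · simp only [Op.fn]
    exact (Nat.sub_le _ _).trans (hx.trans (Nat.pow_le_pow_right (by omega) (by omega)))
  · simp only [Op.fn]
    nlinarith [Nat.mul_le_mul hx hy]
  · simp only [Op.fn]
    split_ifs <;> omega
  · simp only [Op.fn]
    split_ifs <;> omega

/-- Arithmetic terms with sums: `sum i t` is the sum of the values of `t` when register `i` runs
through the numbers below the content of register `0`. -/
inductive Tm : Type
  | const (k : ℕ)
  | reg (r : ℕ)
  | cell (a : ℕ) (t : Tm)
  | bin (o : Op) (s t : Tm)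
  | sum (i : ℕ) (t : Tm)

/-- The value of a term. -/
def Tm.eval : Tm → Store → ℕ
  | .const k, _ => k
  | .reg r, σ => σ.reg r
  | .cell a t, σ => σ.arr a (t.eval σ)
  | .bin o s t, σ => o.fn (s.eval σ) (t.eval σ)
  | .sum i t, σ => ∑ k ∈ Finset.range (σ.reg 0), t.eval (σ.setReg i k)

/-- All registers in the term are smaller than `e`, and register `0` is not bound. -/
def Tm.Below (e : ℕ) : Tm → Prop
  | .const _ => True
  | .reg r => r < e
  | .cell _ t => t.Below e
  | .bin _ s t => s.Below e ∧ t.Below e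
  | .sum i t => 0 < i ∧ i < e ∧ t.Below e

/-- An exponent bounding the values of the term. -/
def Tm.deg : Tm → ℕ
  | .const k => k
  | .reg _ => 1
  | .cell _ t => t.deg + 1
  | .bin _ s t => s.deg + t.deg + 1
  | .sum _ t => t.deg + 1

/-- The nesting depth of the sums. -/
def Tm.depth : Tm → ℕ
  | .const _ => 0
  | .reg _ => 0
  | .cell _ t => t.depth
  | .bin _ s t => max s.depth t.depth
  | .sum _ t => t.depth + 1

/-- The constant factor in the running time of the evaluation. -/
def Tm.cost : Tm → ℕ
  | .const _ => 2
  | .reg _ => 2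
  | .cell _ t => t.cost + 3
  | .bin _ s t => s.cost + t.cost + 4
  | .sum _ t => t.cost + 24

/-- A program that stores the value of a term in register `d`, using the registers from `d` on as
working space. -/
def Tm.compile : Tm → ℕ → Program
  | .const k, d => .setReg d (.const k)
  | .reg r, d => .setReg d (.reg r)
  | .cell a t, d => .seq (t.compile d) (.setReg d (.cell a (.reg d)))
  | .bin o s t, d => .seq (s.compile d)
      (.seq (t.compile (d + 1)) (.setReg d (o.expr (.reg d) (.reg (d + 1)))))
  | .sum i t, d => .seq (.setReg (d + 1) (.reg i)) (.seq (.setReg d (.const 0))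
      (.seq (.setReg i (.const 0)) (.seq
        (.while i (.seq (t.compile (d + 2)) (.seq
          (.setReg d (.add (.reg d) (.reg (d + 2)))) (.setReg i (.add (.reg i) (.const 1))))))
        (.setReg i (.reg (d + 1))))))

/-- Register `0` holds `n`, and the registers below `e` and the array cells hold numbers of size at
most `n + 1`. -/
structure Small (n e : ℕ) (σ : Store) : Prop where
  reg_zero : σ.reg 0 = n
  reg_le : ∀ r < e, σ.reg r ≤ n + 1
  arr_le : ∀ a k, σ.arr a k ≤ n + 1

/-- The arrays and the registers below `d` agree. -/
structure Agree (d : ℕ) (σ τ : Store) : Prop where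
  reg : ∀ r < d, τ.reg r = σ.reg r
  arr : τ.arr = σ.arr

theorem Agree.small {n e : ℕ} {σ τ : Store} (h : Agree e σ τ) (he : 0 < e) (hs : Small n e σ) :
    Small n e τ :=
  ⟨(h.reg 0 he).trans hs.reg_zero, fun r hr => (h.reg r hr).trans_le (hs.reg_le r hr),
    fun a k => by rw [h.arr]; exact hs.arr_le a k⟩

theorem Agree.mono {d e : ℕ} {σ τ : Store} (h : Agree d σ τ) (hed : e ≤ d) : Agree e σ τ :=
  ⟨fun r hr => h.reg r (hr.trans_le hed), h.arr⟩

theorem Agree.trans {d : ℕ} {σ τ υ : Store} (h : Agree d σ τ) (h' : Agree d τ υ) : Agree d σ υ :=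
  ⟨fun r hr => (h'.reg r hr).trans (h.reg r hr), h'.arr.trans h.arr⟩

theorem Small.setReg {n e i k : ℕ} {σ : Store} (h : Small n e σ) (hi : 0 < i) (hk : k ≤ n + 1) :
    Small n e (σ.setReg i k) := by
  refine ⟨?_, fun r hr => ?_, h.arr_le⟩
  · rw [Store.setReg_reg, if_neg hi.ne, h.reg_zero]
  · rw [Store.setReg_reg]
    split_ifs
    exacts [hk, h.reg_le r hr]

theorem Tm.eval_congr {e : ℕ} (he : 0 < e) {t : Tm} (ht : t.Below e) {σ τ : Store}
    (h : Agree e σ τ) : t.eval τ = t.eval σ := by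
  induction t generalizing σ τ with
  | const k => rfl
  | reg r => exact h.reg r ht
  | cell a t ih => rw [Tm.eval, Tm.eval, ih ht h, h.arr]
  | bin o s t ihs iht => rw [Tm.eval, Tm.eval, ihs ht.1 h, iht ht.2 h]
  | sum i t ih =>
    rw [Tm.eval, Tm.eval, h.reg 0 he]
    refine Finset.sum_congr rfl fun k _ => ih ht.2.2 ⟨fun r hr => ?_, h.arr⟩
    simp only [Store.setReg_reg, h.reg r hr]

theorem Tm.eval_le {n e : ℕ} {t : Tm} (ht : t.Below e) {σ : Store} (h : Small n e σ) :
    t.eval σ ≤ (n + 2) ^ t.deg := by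
  induction t generalizing σ with
  | const k => exact (Nat.lt_two_pow_self).le.trans (Nat.pow_le_pow_left (by omega) k)
  | reg r =>
    have := h.reg_le r ht
    simp only [Tm.eval, Tm.deg, pow_one]
    omega
  | cell a t ih =>
    have h1 := h.arr_le a (t.eval σ)
    have h2 : n + 2 ≤ (n + 2) ^ (t.deg + 1) := Nat.le_self_pow (by omega) _
    simp only [Tm.eval, Tm.deg]
    omega
  | bin o s t ihs iht => exact o.fn_le (by omega) (ihs ht.1 h) (iht ht.2 h)
  | sum i t ih =>
    simp only [Tm.eval, Tm.deg, h.reg_zero]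
    calc ∑ k ∈ Finset.range n, t.eval (σ.setReg i k)
        ≤ ∑ k ∈ Finset.range n, (n + 2) ^ t.deg := by
          refine Finset.sum_le_sum fun k hk => ih ht.2.2 (h.setReg ht.1 ?_)
          have := Finset.mem_range.1 hk
          omega
      _ = (n + 2) ^ t.deg * n := by simp [mul_comm]
      _ ≤ (n + 2) ^ (t.deg + 1) := by
        rw [pow_succ]
        exact Nat.mul_le_mul_left _ (by omega)

/-- Per-iteration overhead `c` and one-time overhead `c'` are absorbed into the constant; one loop
raises the exponent by one. -/
theorem loop_time_le {n K m c c' : ℕ} :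
    n * (K * (n + 1) ^ m + c) + c' ≤ (K + c + c') * (n + 1) ^ (m + 1) := by
  have h1 : 1 ≤ (n + 1) ^ m := Nat.one_le_pow _ _ (by omega)
  have h2 : n * c + c' ≤ (c + c') * (n + 1) := by nlinarith
  calc n * (K * (n + 1) ^ m + c) + c' = K * (n + 1) ^ m * n + (n * c + c') := by ring
    _ ≤ K * (n + 1) ^ m * (n + 1) + (c + c') * (n + 1) := by
      exact add_le_add (Nat.mul_le_mul_left _ (by omega)) h2
    _ ≤ K * (n + 1) ^ m * (n + 1) + (c + c') * (n + 1) * (n + 1) ^ m := by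
      exact Nat.add_le_add_left (Nat.le_mul_of_pos_right _ h1) _
    _ = (K + c + c') * (n + 1) ^ (m + 1) := by ring

/-- The compiled program computes the value of the term. -/
theorem Tm.runs_compile {n e c : ℕ} (he : 0 < e) {t : Tm} (ht : t.Below e) (hc : t.deg < c)
    {d : ℕ} (hd : e ≤ d) {σ : Store} (h : Small n e σ) :
    Runs ((n + 2) ^ c) (t.compile d) σ (t.cost * (n + 1) ^ t.depth)
      fun τ => Agree d σ τ ∧ τ.reg d = t.eval σ := by
  have lt_of_le : ∀ {x k : ℕ}, x ≤ (n + 2) ^ k → k < c → x < (n + 2) ^ c := fun h1 h2 =>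
    h1.trans_lt (Nat.pow_lt_pow_right (by omega) h2)
  have hW1 : 1 < (n + 2) ^ c := Nat.one_lt_pow (by omega) (by omega)
  have hWn : n + 1 < (n + 2) ^ c := by
    have : n + 2 ≤ (n + 2) ^ c := Nat.le_self_pow (by omega) _
    omega
  have agree : ∀ (σ : Store) (d k : ℕ), Agree d σ (σ.setReg d k) := fun σ d k =>
    ⟨fun r hr => by rw [Store.setReg_reg, if_neg hr.ne], rfl⟩
  have one_le : ∀ k, 1 ≤ (n + 1) ^ k := fun k => Nat.one_le_pow _ _ (by omega)
  induction t generalizing d σ with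
  | const k =>
    refine (Runs.setReg (x := .const k) ?_ ⟨agree _ _ _, ?_⟩).mono ?_ fun _ h => h
    · exact lt_of_le (eval_le (t := .const k) ht h) hc
    · simp [Expr.cost, Tm.cost, Tm.depth]
    · simp [Expr.eval, Tm.eval]
  | reg r =>
    refine (Runs.setReg (x := .reg r) ?_ ⟨agree _ _ _, ?_⟩).mono ?_ fun _ h => h
    · exact lt_of_le (eval_le (t := .reg r) ht h) hc
    · simp [Expr.cost, Tm.cost, Tm.depth]
    · simp [Expr.eval, Tm.eval]
  | cell a t ih =>
    have hc' : t.deg < c := by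
      simp only [Tm.deg] at hc
      omega
    refine ((ih ht hc' hd h).seq (T := 3) fun τ hτ => ?_).mono ?_ fun _ h => h
    · have hs := (hτ.1.mono hd).small he h
      refine Runs.setReg (x := .cell a (.reg d)) ⟨?_, ?_⟩ ⟨hτ.1.trans (agree _ _ _), ?_⟩
      · exact hτ.2.trans_lt (lt_of_le (eval_le (t := t) ht h) hc')
      · exact (hs.arr_le _ _).trans_lt hWn
      · simp [Expr.eval, Tm.eval, hτ.2, hτ.1.arr]
    · simp only [Tm.cost, Tm.depth, add_mul]
      have := one_le t.depth
      omega
  | bin o s t ihs iht =>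
    have hc1 : s.deg < c := by
      simp only [Tm.deg] at hc
      omega
    have hc2 : t.deg < c := by
      simp only [Tm.deg] at hc
      omega
    refine ((ihs ht.1 hc1 hd h).seq (T := t.cost * (n + 1) ^ t.depth + 4) fun τ hτ => ?_).mono ?_
      fun _ h => h
    · have hs := (hτ.1.mono hd).small he h
      refine (iht ht.2 hc2 (hd.trans (Nat.le_succ d)) hs).seq fun υ hυ => ?_
      have e1 : υ.reg d = s.eval σ := (hυ.1.reg d (Nat.lt_succ_self d)).trans hτ.2
      have e2 : υ.reg (d + 1) = t.eval σ := hυ.2.trans (eval_congr he ht.2 (hτ.1.mono hd))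
      refine (Runs.setReg (x := o.expr (.reg d) (.reg (d + 1))) ?_ ⟨?_, ?_⟩).mono ?_ fun _ h => h
      · refine o.fits_expr ?_ ?_ ?_ hW1
        · exact e1.trans_lt (lt_of_le (eval_le ht.1 h) hc1)
        · exact e2.trans_lt (lt_of_le (eval_le ht.2 h) hc2)
        · simp only [Expr.eval, e1, e2]
          exact lt_of_le (eval_le (t := .bin o s t) ht h) hc
      · simp [Op.cost_expr, Expr.cost]
      · exact (hτ.1.trans (hυ.1.mono (Nat.le_succ d))).trans (agree _ _ _)
      · simp [Op.eval_expr, Expr.eval, e1, e2, Tm.eval]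
    · simp only [Tm.cost, Tm.depth]
      have h1 : (n + 1) ^ s.depth ≤ (n + 1) ^ max s.depth t.depth :=
        Nat.pow_le_pow_right (by omega) (le_max_left _ _)
      have h2 : (n + 1) ^ t.depth ≤ (n + 1) ^ max s.depth t.depth :=
        Nat.pow_le_pow_right (by omega) (le_max_right _ _)
      have h3 := one_le (max s.depth t.depth)
      nlinarith [Nat.mul_le_mul_left s.cost h1, Nat.mul_le_mul_left t.cost h2]
  | sum i t ih =>
    obtain ⟨hi0, hie, ht⟩ := ht
    have hid : i < d := hie.trans_le hd
    have hc' : t.deg < c := by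
      simp only [Tm.deg] at hc
      omega
    -- Register `d` accumulates the sum, `d + 1` saves the old content of `i`, and the summand uses
    -- the registers from `d + 2` on.
    let inv : ℕ → Store → Prop := fun k τ => τ.arr = σ.arr ∧
      (∀ r < d, r ≠ i → τ.reg r = σ.reg r) ∧ τ.reg i = k ∧ τ.reg (d + 1) = σ.reg i ∧
      τ.reg d = ∑ j ∈ Finset.range k, t.eval (σ.setReg i j)
    have reg0 : ∀ k τ, inv k τ → τ.reg 0 = n := fun k τ hτ =>
      (hτ.2.1 0 (he.trans_le hd) hi0.ne).trans h.reg_zero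
    have hsum : ∀ k ≤ n, ∑ j ∈ Finset.range k, t.eval (σ.setReg i j) < (n + 2) ^ c := by
      intro k hk
      refine lt_of_le (le_trans ?_ (eval_le (t := .sum i t) ⟨hi0, hie, ht⟩ h)) hc
      simp only [Tm.eval, h.reg_zero]
      exact Finset.sum_le_sum_of_subset (Finset.range_subset_range.2 hk)
    have body : ∀ k τ, k < n → inv k τ → Runs ((n + 2) ^ c) (.seq (t.compile (d + 2)) (.seq
        (.setReg d (.add (.reg d) (.reg (d + 2)))) (.setReg i (.add (.reg i) (.const 1))))) τ
        (t.cost * (n + 1) ^ t.depth + (4 + 4)) (inv (k + 1)) := by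
      intro k τ hk hτ
      obtain ⟨h1, h2, h3, h4, h5⟩ := id hτ
      have hag : Agree e (σ.setReg i k) τ := by
        refine ⟨fun r hr => ?_, h1⟩
        rw [Store.setReg_reg]
        split_ifs with hri
        exacts [hri ▸ h3, h2 r (hr.trans_le hd) hri]
      refine (ih ht hc' (by omega) (hag.small he (h.setReg hi0 (by omega)))).seq fun υ hυ => ?_
      rw [eval_congr he ht hag] at hυ
      have e1 : υ.reg d = ∑ j ∈ Finset.range k, t.eval (σ.setReg i j) :=
        (hυ.1.reg d (by omega)).trans h5
      have e2 : υ.reg i = k := (hυ.1.reg i (by omega)).trans h3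
      refine (Runs.setReg (x := .add (.reg d) (.reg (d + 2))) (Q := fun φ => φ = υ.setReg d
        (∑ j ∈ Finset.range (k + 1), t.eval (σ.setReg i j))) ?_ ?_).seq ?_
      · simp only [Expr.Fits, Expr.eval, e1, hυ.2, ← Finset.sum_range_succ]
        exact ⟨hsum k hk.le, lt_of_le (eval_le ht (h.setReg hi0 (by omega))) hc', hsum (k + 1) hk⟩
      · simp only [Expr.eval, e1, hυ.2, ← Finset.sum_range_succ]
      · rintro _ rfl
        refine Runs.setReg (x := .add (.reg i) (.const 1)) ?_ ?_
        · simp only [Expr.Fits, Expr.eval, Store.setReg_reg, hid.ne, if_false, e2]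
          omega
        · refine ⟨hυ.1.arr.trans h1, fun r hr hri => ?_, ?_, ?_, ?_⟩
          · simp [hri, hr.ne, hυ.1.reg r (by omega), h2 r hr hri]
          · simp [Expr.eval, hid.ne, e2]
          · have : d + 1 ≠ i := by omega
            simp [this, hυ.1.reg (d + 1) (by omega), h4]
          · simp [hid.ne.symm]
    have main : Runs ((n + 2) ^ c) ((Tm.sum i t).compile d) σ
        (2 + (2 + (2 + ((n * (t.cost * (n + 1) ^ t.depth + (4 + 4) + 4) + 4) + 2))))
        fun τ => Agree d σ τ ∧ τ.reg d = (Tm.sum i t).eval σ := by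
      refine (Runs.setReg (x := .reg i) (Q := fun τ => τ = σ.setReg (d + 1) (σ.reg i)) ?_ rfl).seq
        ?_
      · exact (h.reg_le i hie).trans_lt hWn
      rintro _ rfl
      refine (Runs.setReg (x := .const 0) (Q := fun τ => τ = Store.setReg _ d 0) ?_ rfl).seq ?_
      · exact Nat.zero_lt_of_lt hW1
      rintro _ rfl
      refine (Runs.setReg (x := .const 0) (Q := inv 0) ?_ ?_).seq ?_
      · exact Nat.zero_lt_of_lt hW1
      · refine ⟨rfl, fun r hr hri => ?_, ?_, ?_, ?_⟩
        · have : r ≠ d + 1 := by omega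
          simp [hri, hr.ne, this]
        · simp [Expr.eval]
        · have : d + 1 ≠ i := by omega
          simp [this]
        · simp [hid.ne.symm]
      intro τ hτ
      refine (Runs.while (inv := inv) (by omega) hW1 (fun k τ hτ => ⟨hτ.2.2.1, reg0 k τ hτ⟩) body
        hτ).seq ?_
      rintro υ ⟨h1, h2, h3, h4, h5⟩
      refine Runs.setReg (x := .reg (d + 1)) ?_ ⟨⟨fun r hr => ?_, h1⟩, ?_⟩
      · simp only [Expr.Fits, h4]
        exact (h.reg_le i hie).trans_lt hWn
      · simp only [Expr.eval, Store.setReg_reg, h4]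
        split_ifs with hri
        exacts [hri ▸ rfl, h2 r hr hri]
      · simp [hid.ne.symm, h5, Tm.eval, h.reg_zero]
    refine main.mono ?_ fun _ h => h
    -- Each round adds 8 steps for the two assignments and 4 for the test. Outside the rounds there
    -- are 4 assignments of 2 steps and a last test of 4. Together these account for the 24 in
    -- `Tm.cost`.
    have := loop_time_le (n := n) (K := t.cost) (m := t.depth) (c := 12) (c' := 12)
    simp only [Tm.cost, Tm.depth]
    rw [show t.cost + 24 = t.cost + 12 + 12 from rfl]
    refine le_trans (le_of_eq ?_) this
    ring

/-! ### Logic by arithmetic terms -/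

/-- The number `k` is the truth value of `P`. -/
def IsTruth (k : ℕ) (P : Prop) : Prop := (P → k = 1) ∧ (¬ P → k = 0)

theorem isTruth_iff {k : ℕ} {P : Prop} [Decidable P] : IsTruth k P ↔ k = if P then 1 else 0 := by
  unfold IsTruth
  split_ifs with h <;> simp [h]

/-- The value of the term is the truth value of `P`. -/
def Decides (t : Tm) (σ : Store) (P : Prop) : Prop := IsTruth (t.eval σ) P

namespace Tm

/-- Negation. -/
def not (t : Tm) : Tm := .bin .eq t (.const 0)

/-- Conjunction. -/
def and (s t : Tm) : Tm := .bin .mul s t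

/-- Disjunction. -/
def or (s t : Tm) : Tm := .bin .lt (.const 0) (.bin .add s t)

/-- Equivalence. -/
def iff (s t : Tm) : Tm := .bin .eq s t

/-- Universal quantification of register `i` over the numbers below register `0`. -/
def all (i : ℕ) (t : Tm) : Tm := .bin .eq (.sum i t) (.reg 0)

/-- Existential quantification of register `i` over the numbers below register `0`. -/
def ex (i : ℕ) (t : Tm) : Tm := .bin .lt (.const 0) (.sum i t)

/-- Case distinction. -/
def ite (c s t : Tm) : Tm := .bin .add (.bin .mul c s) (.bin .mul c.not t)

/-- Cell `reg 0 * reg r + reg s` of array `a`. -/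
def entry (a r s : ℕ) : Tm := .cell a (.bin .add (.bin .mul (.reg 0) (.reg r)) (.reg s))

/-- Equality of two registers. -/
def same (r s : ℕ) : Tm := .bin .eq (.reg r) (.reg s)

/-- Membership in a closed neighbourhood, by the adjacency matrix in array `0`. -/
def cAdj (r s : ℕ) : Tm := (same r s).or (entry 0 r s)

end Tm

section Decides

variable {s t : Tm} {σ : Store} {P Q : Prop}

theorem Decides.congr (h : Decides t σ P) (hPQ : P ↔ Q) : Decides t σ Q := by
  rwa [Decides, ← hPQ]

theorem Decides.not (h : Decides t σ P) : Decides t.not σ (¬ P) := by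
  unfold Decides IsTruth at *
  by_cases hP : P <;> simp_all [Tm.not, Tm.eval, Op.fn]

theorem Decides.and (hs : Decides s σ P) (ht : Decides t σ Q) : Decides (s.and t) σ (P ∧ Q) := by
  unfold Decides IsTruth at *
  by_cases hP : P <;> by_cases hQ : Q <;> simp_all [Tm.and, Tm.eval, Op.fn]

theorem Decides.or (hs : Decides s σ P) (ht : Decides t σ Q) : Decides (s.or t) σ (P ∨ Q) := by
  unfold Decides IsTruth at *
  by_cases hP : P <;> by_cases hQ : Q <;> simp_all [Tm.or, Tm.eval, Op.fn]

theorem Decides.iff (hs : Decides s σ P) (ht : Decides t σ Q) : Decides (s.iff t) σ (P ↔ Q) := by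
  unfold Decides IsTruth at *
  by_cases hP : P <;> by_cases hQ : Q <;> simp_all [Tm.iff, Tm.eval, Op.fn]

/-- Both branches are always evaluated and the unwanted one is multiplied by zero. This costs only a
constant factor, as the depth is the maximum over the parts. -/
theorem Decides.eval_ite [Decidable P] (h : Decides t σ P) (x y : Tm) :
    (t.ite x y).eval σ = if P then x.eval σ else y.eval σ := by
  have h' := h.not
  unfold Decides IsTruth at *
  by_cases hP : P <;> simp_all [Tm.ite, Tm.eval, Op.fn]

theorem eval_sum {n : ℕ} (h0 : σ.reg 0 = n) (i : ℕ) :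
    (Tm.sum i t).eval σ = ∑ x : Fin n, t.eval (σ.setReg i x) := by
  rw [Tm.eval, h0, Finset.sum_range]

theorem eval_sum_decides {n : ℕ} (h0 : σ.reg 0 = n) {i : ℕ} {p : Fin n → Prop} [DecidablePred p]
    (h : ∀ x : Fin n, Decides t (σ.setReg i x) (p x)) :
    (Tm.sum i t).eval σ = (Finset.univ.filter p).card := by
  rw [eval_sum h0, Finset.card_filter]
  exact Finset.sum_congr rfl fun x _ => isTruth_iff.1 (h x)

theorem Decides.all {n : ℕ} (h0 : σ.reg 0 = n) {i : ℕ} {p : Fin n → Prop}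
    (h : ∀ x : Fin n, Decides t (σ.setReg i x) (p x)) : Decides (t.all i) σ (∀ x, p x) := by
  classical
  have h1 : (Finset.univ.filter p).card = n ↔ ∀ x, p x := by
    have := Finset.card_eq_iff_eq_univ (Finset.univ.filter p)
    rw [Fintype.card_fin, Finset.filter_eq_self] at this
    simpa using this
  have h2 := eval_sum_decides h0 h
  rw [Decides, isTruth_iff, Tm.all, Tm.eval, h2, Tm.eval, h0]
  simp only [Op.fn, h1]

theorem Decides.ex {n : ℕ} (h0 : σ.reg 0 = n) {i : ℕ} {p : Fin n → Prop}
    (h : ∀ x : Fin n, Decides t (σ.setReg i x) (p x)) : Decides (t.ex i) σ (∃ x, p x) := by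
  classical
  have h1 : 0 < (Finset.univ.filter p).card ↔ ∃ x, p x := by
    simp [Finset.card_pos, Finset.filter_nonempty_iff]
  have h2 := eval_sum_decides h0 h
  rw [Decides, isTruth_iff, Tm.ex, Tm.eval, h2, Tm.eval]
  simp only [Op.fn, h1]

theorem decides_same {n : ℕ} {r r' : ℕ} {x y : Fin n} (hx : σ.reg r = x) (hy : σ.reg r' = y) :
    Decides (Tm.same r r') σ (x = y) := by
  rw [Decides, isTruth_iff]
  simp only [Tm.same, Tm.eval, Op.fn, hx, hy, Fin.ext_iff]

end Decides

/-! ### The formula as a term over precomputed tables -/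

section Tables

variable {n : ℕ} {G : SimpleGraph (Fin n)} {σ : Store}

/-- Array `a` holds the truth values of the binary relation `p`. -/
def HasTable (a : ℕ) (p : Fin n → Fin n → Prop) (σ : Store) : Prop :=
  ∀ x y : Fin n, IsTruth (σ.arr a (n * x + y)) (p x y)

theorem HasTable.decides {a r s : ℕ} {p : Fin n → Fin n → Prop} (h : HasTable a p σ)
    (h0 : σ.reg 0 = n) {x y : Fin n} (hx : σ.reg r = x) (hy : σ.reg s = y) :
    Decides (Tm.entry a r s) σ (p x y) := by
  simpa only [Decides, Tm.entry, Tm.eval, Op.fn, h0, hx, hy] using h x y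

/-- The store holds the graph in array `0`. -/
structure Holds (G : SimpleGraph (Fin n)) (σ : Store) : Prop where
  reg_zero : σ.reg 0 = n
  adj : HasTable 0 G.Adj σ

theorem Holds.setReg (h : Holds G σ) {i : ℕ} (hi : 0 < i) (k : ℕ) : Holds G (σ.setReg i k) :=
  ⟨by rw [Store.setReg_reg, if_neg hi.ne, h.reg_zero], h.adj⟩

theorem Holds.decides_adj (h : Holds G σ) {r s : ℕ} {x y : Fin n} (hx : σ.reg r = x)
    (hy : σ.reg s = y) : Decides (Tm.entry 0 r s) σ (G.Adj x y) :=
  h.adj.decides h.reg_zero hx hy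

theorem Holds.decides_cAdj (h : Holds G σ) {r s : ℕ} {x y : Fin n} (hx : σ.reg r = x)
    (hy : σ.reg s = y) : Decides (Tm.cAdj r s) σ (CAdj G x y) :=
  (decides_same hx hy).or (h.decides_adj hx hy)

/-- `{reg 1, reg 2}` is dominating. -/
def domTm : Tm := ((Tm.cAdj 1 3).or (Tm.cAdj 2 3)).all 3

theorem Holds.decides_domTm (h : Holds G σ) {x y : Fin n} (hx : σ.reg 1 = x) (hy : σ.reg 2 = y) :
    Decides domTm σ (Dom2 G x y) :=
  Decides.all h.reg_zero fun w => by
    have h' := h.setReg (i := 3) (by norm_num) w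
    exact (h'.decides_cAdj (by simpa using hx) (by simp)).or
      (h'.decides_cAdj (by simpa using hy) (by simp))

open Classical in
/-- The vertices with the same closed neighbourhood as `u`. -/
noncomputable def twins (G : SimpleGraph (Fin n)) (u : Fin n) : Finset (Fin n) :=
  Finset.univ.filter fun v => ∀ x, CAdj G u x ↔ CAdj G v x

/-- The number of twins of `reg 1`. -/
def twinsTm : Tm := .sum 2 (((Tm.cAdj 1 3).iff (Tm.cAdj 2 3)).all 3)

theorem Holds.eval_twinsTm (h : Holds G σ) {x : Fin n} (hx : σ.reg 1 = x) :
    twinsTm.eval σ = (twins G x).card := by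
  classical
  refine (eval_sum_decides (p := fun y => ∀ w, CAdj G x w ↔ CAdj G y w) h.reg_zero fun y => ?_).trans
    (by simp only [twins])
  · have h' := h.setReg (i := 2) (by norm_num) y
    refine Decides.all h'.reg_zero fun w => ?_
    have h'' := h'.setReg (i := 3) (by norm_num) w
    exact (h''.decides_cAdj (by simpa using hx) (by simp)).iff (h''.decides_cAdj (by simp) (by simp))

open Classical in
/-- The vertices missed by `a` and `b`, as a finset. -/
noncomputable def missed (G : SimpleGraph (Fin n)) (a b : Fin n) : Finset (Fin n) :=
  Finset.univ.filter fun u => ¬ CAdj G a u ∧ ¬ CAdj G b u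

/-- Missed sets are closed under true twins, so each summand is at most the size of the missed set.
Equality of the sums forces equality in every summand, that is, each twin class is the whole missed
set. Given the class sizes, the test takes linear time per pair instead of comparing all pairs of
missed vertices. -/
theorem sum_card_twins_eq_iff (a b : Fin n) :
    ∑ u ∈ missed G a b, (twins G u).card = (missed G a b).card * (missed G a b).card ↔
      ∀ u ∈ Missed G a b, ∀ v ∈ Missed G a b, ∀ x, CAdj G u x ↔ CAdj G v x := by
  have mem : ∀ u, u ∈ missed G a b ↔ u ∈ Missed G a b := by simp [missed, Missed]
  have memT : ∀ u v, v ∈ twins G u ↔ ∀ x, CAdj G u x ↔ CAdj G v x := by simp [twins]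
  have hsub : ∀ u ∈ missed G a b, twins G u ⊆ missed G a b := by
    intro u hu v hv
    rw [mem] at hu ⊢
    rw [memT] at hv
    exact ⟨fun h => hu.1 ((hv a).2 h.symm).symm, fun h => hu.2 ((hv b).2 h.symm).symm⟩
  simp only [← mem, ← memT]
  rw [← smul_eq_mul, ← Finset.sum_const,
    Finset.sum_eq_sum_iff_of_le fun u hu => Finset.card_le_card (hsub u hu)]
  refine forall₂_congr fun u hu => ⟨fun h v hv => ?_, fun h => ?_⟩
  · rwa [Finset.eq_of_subset_of_card_le (hsub u hu) h.ge]
  · rw [(hsub u hu).antisymm h]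

/-- All vertices are adjacent. -/
def completeTm : Tm := ((Tm.cAdj 1 2).all 2).all 1

theorem Holds.decides_completeTm (h : Holds G σ) :
    Decides completeTm σ (∀ a b, CAdj G a b) :=
  Decides.all h.reg_zero fun a => by
    have h1 := h.setReg (i := 1) (by norm_num) a
    refine Decides.all h1.reg_zero fun b => ?_
    exact (h1.setReg (i := 2) (by norm_num) b).decides_cAdj (by simp) (by simp)

/-- There is a secure pair, by the table of the dominating pairs in array `1`. -/
def securePairTm : Tm :=
  (((Tm.entry 1 1 2).and (((Tm.same 3 1).or ((Tm.same 3 2).or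
    (((Tm.entry 0 3 1).and (Tm.entry 1 3 2)).or
      ((Tm.entry 0 3 2).and (Tm.entry 1 3 1))))).all 3)).ex 2).ex 1

theorem Holds.decides_securePairTm (h : Holds G σ) (hD : HasTable 1 (Dom2 G) σ) :
    Decides securePairTm σ (∃ a b, SecurePair G a b) :=
  Decides.ex h.reg_zero fun a => by
    have h1 := h.setReg (i := 1) (by norm_num) a
    refine Decides.ex h1.reg_zero fun b => ?_
    have h2 := h1.setReg (i := 2) (by norm_num) b
    have hD2 : HasTable 1 (Dom2 G) ((σ.setReg 1 a).setReg 2 b) := hD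
    refine (hD2.decides h2.reg_zero (by simp) (by simp)).and (Decides.all h2.reg_zero fun u => ?_)
    have h3 := h2.setReg (i := 3) (by norm_num) u
    have hD3 : HasTable 1 (Dom2 G) (((σ.setReg 1 a).setReg 2 b).setReg 3 u) := hD
    have r1 : (((σ.setReg 1 a).setReg 2 b).setReg 3 u).reg 1 = a := by simp
    have r2 : (((σ.setReg 1 a).setReg 2 b).setReg 3 u).reg 2 = b := by simp
    have r3 : (((σ.setReg 1 a).setReg 2 b).setReg 3 u).reg 3 = u := by simp
    exact (decides_same r3 r1).or ((decides_same r3 r2).or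
      (((h3.decides_adj r3 r1).and (hD3.decides h3.reg_zero r3 r2)).or
        ((h3.decides_adj r3 r2).and (hD3.decides h3.reg_zero r3 r1))))

/-- The number of pendant vertices. -/
def pendantTm : Tm :=
  .sum 1 (((Tm.entry 0 1 2).and (((Tm.entry 0 1 3).not.or (Tm.same 3 2)).all 3)).ex 2)

theorem Holds.eval_pendantTm (h : Holds G σ) :
    pendantTm.eval σ = {s | Pendant G s}.ncard := by
  classical
  have key : ∀ s : Fin n, Decides (((Tm.entry 0 1 2).and
      (((Tm.entry 0 1 3).not.or (Tm.same 3 2)).all 3)).ex 2) (σ.setReg 1 s) (Pendant G s) := by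
    intro s
    have h1 := h.setReg (i := 1) (by norm_num) s
    refine Decides.ex h1.reg_zero fun c => ?_
    have h2 := h1.setReg (i := 2) (by norm_num) c
    refine (h2.decides_adj (by simp) (by simp)).and (Decides.all h2.reg_zero fun w => ?_)
    have h3 := h2.setReg (i := 3) (by norm_num) w
    exact ((h3.decides_adj (x := s) (y := w) (by simp) (by simp)).not.or
      (decides_same (x := w) (y := c) (by simp) (by simp))).congr imp_iff_not_or.symm
  rw [pendantTm, eval_sum_decides h.reg_zero key, ← Set.ncard_coe_finset]
  congr 1
  ext
  simp

/-- `reg 3` is missed by `reg 1` and `reg 2`. -/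
def missedTm : Tm := (Tm.cAdj 1 3).not.and (Tm.cAdj 2 3).not

/-- There is a twin triple, by the table of the dominating pairs in array `1` and the numbers of
twins in array `2`. -/
def twinTripleTm : Tm :=
  (((((Tm.entry 1 1 3).and (Tm.entry 1 2 3)).ex 3).and
    (.bin .eq (.sum 3 (.bin .mul missedTm (.cell 2 (.reg 3))))
      (.bin .mul (.sum 3 missedTm) (.sum 3 missedTm)))).ex 2).ex 1

theorem Holds.decides_twinTripleTm (h : Holds G σ) (hD : HasTable 1 (Dom2 G) σ)
    (hT : ∀ u : Fin n, σ.arr 2 u = (twins G u).card) :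
    Decides twinTripleTm σ (∃ a b c, TwinTriple G a b c) :=
  Decides.ex h.reg_zero fun a => by
    classical
    have h1 := h.setReg (i := 1) (by norm_num) a
    refine Decides.ex h1.reg_zero fun b => ?_
    have h2 := h1.setReg (i := 2) (by norm_num) b
    -- The search for `c` is independent of the twin test, which involves only `a` and `b`. The two
    -- searches therefore run side by side and are not nested.
    have hc : Decides (((Tm.entry 1 1 3).and (Tm.entry 1 2 3)).ex 3) ((σ.setReg 1 a).setReg 2 b)
        (∃ c, Dom2 G a c ∧ Dom2 G b c) := by
      refine Decides.ex h2.reg_zero fun c => ?_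
      have h3 := h2.setReg (i := 3) (by norm_num) c
      have hD3 : HasTable 1 (Dom2 G) (((σ.setReg 1 a).setReg 2 b).setReg 3 c) := hD
      exact (hD3.decides h3.reg_zero (by simp) (by simp)).and
        (hD3.decides h3.reg_zero (by simp) (by simp))
    have hm : ∀ u : Fin n, Decides missedTm (((σ.setReg 1 a).setReg 2 b).setReg 3 u)
        (¬ CAdj G a u ∧ ¬ CAdj G b u) := by
      intro u
      have h3 := h2.setReg (i := 3) (by norm_num) u
      exact (h3.decides_cAdj (by simp) (by simp)).not.and
        (h3.decides_cAdj (by simp) (by simp)).not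
    have hm1 : (Tm.sum 3 missedTm).eval ((σ.setReg 1 a).setReg 2 b) = (missed G a b).card :=
      (eval_sum_decides h2.reg_zero hm).trans (by simp only [missed])
    have hm2 : (Tm.sum 3 (.bin .mul missedTm (.cell 2 (.reg 3)))).eval
        ((σ.setReg 1 a).setReg 2 b) = ∑ u ∈ missed G a b, (twins G u).card := by
      rw [eval_sum h2.reg_zero, missed, Finset.sum_filter]
      refine Finset.sum_congr rfl fun u _ => ?_
      have := hm u
      rw [Decides, isTruth_iff] at this
      simp only [Tm.eval, Op.fn, this, Store.setReg_reg, Store.setReg_arr, if_true, hT, ite_mul,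
        one_mul, zero_mul]
    have hs : Decides (.bin .eq (.sum 3 (.bin .mul missedTm (.cell 2 (.reg 3))))
        (.bin .mul (.sum 3 missedTm) (.sum 3 missedTm))) ((σ.setReg 1 a).setReg 2 b)
        (∀ u ∈ Missed G a b, ∀ v ∈ Missed G a b, ∀ x, CAdj G u x ↔ CAdj G v x) := by
      rw [← sum_card_twins_eq_iff]
      rw [Decides, isTruth_iff, Tm.eval, hm2, Tm.eval, hm1]
      simp only [Op.fn]
      congr
    refine (hc.and hs).congr ?_
    simp only [TwinTriple, ← and_assoc, exists_and_right]

/-- The weak Roman domination number. -/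
def gammaTm : Tm :=
  completeTm.ite (.const 1) (securePairTm.ite (.const 2)
    ((Tm.bin .lt (.const 0) pendantTm).ite
      (.bin .add pendantTm ((Tm.bin .eq (.reg 0) (.bin .mul (.const 2) pendantTm)).ite
        (.const 0) (.const 1)))
      (twinTripleTm.ite (.const 3) (.const 4))))

theorem Holds.eval_gammaTm (h : Holds G σ) (hD : HasTable 1 (Dom2 G) σ)
    (hT : ∀ u : Fin n, σ.arr 2 u = (twins G u).card) (hG : G.Connected) (ht : Typed G) :
    gammaTm.eval σ = gammaR G := by
  classical
  have hp := h.eval_pendantTm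
  have h1 : Decides (.bin .lt (.const 0) pendantTm) σ (0 < {s | Pendant G s}.ncard) := by
    rw [Decides, isTruth_iff, Tm.eval, hp]
    simp only [Op.fn, Tm.eval]
    congr
  have h2 : Decides (.bin .eq (.reg 0) (.bin .mul (.const 2) pendantTm)) σ
      (Fintype.card (Fin n) = 2 * {s | Pendant G s}.ncard) := by
    rw [Decides, isTruth_iff, Tm.eval, Tm.eval, Tm.eval, hp]
    simp only [Op.fn, Tm.eval, h.reg_zero, Fintype.card_fin]
  rw [gammaTm, h.decides_completeTm.eval_ite, (h.decides_securePairTm hD).eval_ite, h1.eval_ite,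
    (h.decides_twinTripleTm hD hT).eval_ite, gammaR_eq hG ht]
  have h3 := h2.eval_ite (.const 0) (.const 1)
  simp only [Tm.eval, Op.fn, hp] at h3 ⊢
  simp only [h3]
  congr

end Tables

/-! ### The program -/

section Program

variable {n e c : ℕ} {σ : Store}

/-- `reg i := reg i + 1`. -/
def Program.incr (i : ℕ) : Program := .setReg i (.add (.reg i) (.const 1))

theorem Runs.incr {W i : ℕ} {Q : Store → Prop} (h : σ.reg i + 1 < W)
    (hQ : Q (σ.setReg i (σ.reg i + 1))) : Runs W (.incr i) σ 4 Q :=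
  Runs.setReg (x := .add (.reg i) (.const 1)) (by simp only [Expr.Fits, Expr.eval]; omega) hQ

/-- Store the value of a term in an array cell, using the registers from `e` on as working
space. -/
def Tm.assign (t : Tm) (e a : ℕ) (x : Expr) : Program :=
  .seq (t.compile e) (.setCell a x (.reg e))

/-- The index expression is evaluated after the term, hence the requirement that its value be the
same in every store agreeing with `σ` below the working space. -/
theorem Tm.runs_assign (he : 0 < e) {t : Tm} (ht : t.Below e) (hc : t.deg < c) {a k : ℕ}
    {x : Expr} (hx : ∀ τ, Agree e σ τ → x.Fits ((n + 2) ^ c) τ ∧ x.eval τ = k)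
    (h : Small n e σ) :
    Runs ((n + 2) ^ c) (t.assign e a x) σ (t.cost * (n + 1) ^ t.depth + (x.cost + 2))
      fun υ => (∀ r < e, υ.reg r = σ.reg r) ∧
        ∀ b j, υ.arr b j = if b = a ∧ j = k then t.eval σ else σ.arr b j := by
  refine (t.runs_compile he ht hc le_rfl h).seq fun τ hτ => ?_
  obtain ⟨h1, h2⟩ := hx τ hτ.1
  refine (Runs.setCell h1 (x := .reg e) ?_ ⟨hτ.1.reg, fun b j => ?_⟩).mono ?_ fun _ h => h
  · exact hτ.2.trans_lt ((Tm.eval_le ht h).trans_lt (Nat.pow_lt_pow_right (by omega) hc))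
  · simp [Expr.cost]
  · rw [Store.setCell_arr, h2]
    simp only [Expr.eval, hτ.2, hτ.1.arr]

theorem Small.of_assign {υ : Store} (h : Small n e σ) (he : 0 < e) {a k v : ℕ} (hv : v ≤ n + 1)
    (h1 : ∀ r < e, υ.reg r = σ.reg r)
    (h2 : ∀ b j, υ.arr b j = if b = a ∧ j = k then v else σ.arr b j) : Small n e υ := by
  refine ⟨(h1 0 he).trans h.reg_zero, fun r hr => (h1 r hr).trans_le (h.reg_le r hr), fun b j => ?_⟩
  rw [h2]
  split_ifs
  exacts [hv, h.arr_le b j]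

/-- Write the table of the dominating pairs into array `1`. -/
def domProgram : Program :=
  .seq (.setReg 1 (.const 0)) (.while 1 (.seq
    (.seq (.setReg 2 (.const 0)) (.while 2 (.seq
      (domTm.assign 5 1 (.add (.mul (.reg 0) (.reg 1)) (.reg 2))) (.incr 2))))
    (.incr 1)))

/-- Write the numbers of twins into array `2`. -/
def twinsProgram : Program :=
  .seq (.setReg 1 (.const 0)) (.while 1 (.seq (twinsTm.assign 5 2 (.reg 1)) (.incr 1)))

/-- Compute the weak Roman domination number. -/
def gammaProgram : Program :=
  .seq domProgram (.seq twinsProgram (.seq (gammaTm.compile 5) (.setReg 0 (.reg 5))))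

theorem add_mul_inj {n x y x' y' : ℕ} (hy : y < n) (hy' : y' < n)
    (h : n * x + y = n * x' + y') : x = x' ∧ y = y' := by
  have hn : 0 < n := by omega
  have h1 := congrArg (· / n) h
  simp only [Nat.mul_add_div hn, Nat.div_eq_of_lt hy, Nat.div_eq_of_lt hy'] at h1
  have h2 : x = x' := by simpa using h1
  subst h2
  exact ⟨rfl, by omega⟩

variable {G : SimpleGraph (Fin n)}

theorem Holds.of_assign {υ : Store} (h : Holds G σ) (he : 0 < e) {a k v : ℕ} (ha : 0 < a)
    (h1 : ∀ r < e, υ.reg r = σ.reg r)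
    (h2 : ∀ b j, υ.arr b j = if b = a ∧ j = k then v else σ.arr b j) : Holds G υ := by
  refine ⟨(h1 0 he).trans h.reg_zero, fun x y => ?_⟩
  rw [h2, if_neg fun h => ha.ne h.1]
  exact h.adj x y

theorem domTm_below : domTm.Below 5 := by
  simp [domTm, Tm.all, Tm.or, Tm.cAdj, Tm.same, Tm.entry, Tm.Below]

theorem twinsTm_below : twinsTm.Below 5 := by
  simp [twinsTm, Tm.all, Tm.or, Tm.iff, Tm.cAdj, Tm.same, Tm.entry, Tm.Below]

theorem gammaTm_below : gammaTm.Below 5 := by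
  simp [gammaTm, completeTm, securePairTm, pendantTm, twinTripleTm, missedTm, Tm.ite, Tm.not,
    Tm.and, Tm.ex, Tm.all, Tm.or, Tm.cAdj, Tm.same, Tm.entry, Tm.Below]

theorem gammaTm_depth : gammaTm.depth = 3 := by
  simp [gammaTm, completeTm, securePairTm, pendantTm, twinTripleTm, missedTm, Tm.ite, Tm.not,
    Tm.and, Tm.ex, Tm.all, Tm.or, Tm.cAdj, Tm.same, Tm.entry, Tm.depth]

theorem Decides.eval_le {t : Tm} {P : Prop} (h : Decides t σ P) : t.eval σ ≤ 1 := by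
  classical
  rw [Decides, isTruth_iff] at h
  rw [h]
  split_ifs <;> simp

theorem runs_domProgram (hc : domTm.deg < c) (hc3 : 3 ≤ c) (hS : Small n 5 σ) (hG : Holds G σ) :
    Runs ((n + 2) ^ c) domProgram σ ((domTm.cost + 40) * (n + 1) ^ 3)
      fun τ => Small n 5 τ ∧ Holds G τ ∧ HasTable 1 (Dom2 G) τ := by
  have hW3 : (n + 2) ^ 3 ≤ (n + 2) ^ c := Nat.pow_le_pow_right (by omega) hc3
  have hW : n * n + 2 * n + 2 < (n + 2) ^ c := by
    refine lt_of_lt_of_le ?_ hW3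
    ring_nf
    nlinarith
  let inv : ℕ → Store → Prop := fun k τ => Small n 5 τ ∧ Holds G τ ∧ τ.reg 1 = k ∧
    ∀ x y : Fin n, (x : ℕ) < k → IsTruth (τ.arr 1 (n * x + y)) (Dom2 G x y)
  let inv' : ℕ → ℕ → Store → Prop := fun k l τ => Small n 5 τ ∧ Holds G τ ∧ τ.reg 1 = k ∧
    τ.reg 2 = l ∧ ∀ x y : Fin n, (x : ℕ) < k ∨ ((x : ℕ) = k ∧ (y : ℕ) < l) →
      IsTruth (τ.arr 1 (n * x + y)) (Dom2 G x y)
  have inner : ∀ k l τ, k < n → l < n → inv' k l τ → Runs ((n + 2) ^ c)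
      (.seq (domTm.assign 5 1 (.add (.mul (.reg 0) (.reg 1)) (.reg 2))) (.incr 2)) τ
      (domTm.cost * (n + 1) ^ 1 + 7 + 4) (inv' k (l + 1)) := by
    rintro k l τ hk hl ⟨h1, h2, h3, h4, h5⟩
    have hd := h2.decides_domTm (x := ⟨k, hk⟩) (y := ⟨l, hl⟩) h3 h4
    refine (Tm.runs_assign (k := n * k + l) (by norm_num) domTm_below hc (fun υ hυ => ?_) h1).seq
      fun υ hυ => ?_
    · have e0 := (hυ.reg 0 (by norm_num)).trans h1.reg_zero
      have e1 := (hυ.reg 1 (by norm_num)).trans h3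
      have e2 := (hυ.reg 2 (by norm_num)).trans h4
      have : n * k ≤ n * n := Nat.mul_le_mul_left _ hk.le
      simp only [Expr.Fits, Expr.eval, e0, e1, e2]
      refine ⟨⟨⟨?_, ?_, ?_⟩, ?_, ?_⟩, trivial⟩ <;> omega
    · obtain ⟨r, a⟩ := hυ
      have e1 := (r 1 (by norm_num)).trans h3
      have e2 := (r 2 (by norm_num)).trans h4
      refine Runs.incr (by rw [e2]; nlinarith) ⟨?_, ?_, ?_, ?_, fun x y hxy => ?_⟩
      · exact (h1.of_assign (by norm_num) (hd.eval_le.trans (by omega)) r a).setReg (by norm_num)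
          (by omega)
      · exact (h2.of_assign (by norm_num) (by norm_num) r a).setReg (by norm_num) _
      · simp [e1]
      · simp [e2]
      · rw [Store.setReg_arr, a]
        -- Row-major indexing is injective, so the new cell overwrites no other entry of the table.
        by_cases hxy' : n * (x : ℕ) + y = n * k + l
        · rw [if_pos ⟨rfl, hxy'⟩]
          obtain ⟨rfl, rfl⟩ := add_mul_inj y.2 hl hxy'
          exact hd
        · rw [if_neg fun h => hxy' h.2]
          refine h5 x y (hxy.imp_right fun ⟨hx, hy⟩ => ⟨hx, ?_⟩)
          refine (Nat.lt_succ_iff.1 hy).lt_of_ne fun hyl => hxy' ?_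
          rw [hx, hyl]
  have outer : ∀ k τ, k < n → inv k τ → Runs ((n + 2) ^ c) (.seq
      (.seq (.setReg 2 (.const 0)) (.while 2 (.seq
        (domTm.assign 5 1 (.add (.mul (.reg 0) (.reg 1)) (.reg 2))) (.incr 2))))
      (.incr 1)) τ ((domTm.cost + 25) * (n + 1) ^ 2) (inv (k + 1)) := by
    rintro k τ hk ⟨h1, h2, h3, h4⟩
    refine (Runs.seq (T := 4) (Runs.seq (Q := inv' k n)
      (T := n * (domTm.cost * (n + 1) ^ 1 + 7 + 4 + 4) + 4)
      (Runs.setReg (x := .const 0) (Q := inv' k 0) (Nat.zero_lt_of_lt hW) ?_) ?_) ?_).mono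
      ?_ fun _ h => h
    · refine ⟨h1.setReg (by norm_num) (Nat.zero_le _), h2.setReg (by norm_num) _, ?_, ?_, ?_⟩
      · simp [h3]
      · simp [Expr.eval]
      · rintro x y (hx | ⟨-, hy⟩)
        exacts [h4 x y hx, (Nat.not_lt_zero _ hy).elim]
    · exact fun υ hυ => Runs.while (by nlinarith) (by omega)
        (fun l φ hφ => ⟨hφ.2.2.2.1, hφ.1.reg_zero⟩) (fun l φ hl hφ => inner k l φ hk hl hφ) hυ
    · rintro υ ⟨h1, h2, h3, h4, h5⟩
      refine Runs.incr (by rw [h3]; nlinarith) ⟨h1.setReg (by norm_num) (by omega),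
        h2.setReg (by norm_num) _, by simp [h3], fun x y hx => h5 x y ?_⟩
      rcases Nat.lt_succ_iff_lt_or_eq.1 hx with hx | hx
      exacts [.inl hx, .inr ⟨hx, y.2⟩]
    · have := loop_time_le (n := n) (K := domTm.cost) (m := 1) (c := 15) (c' := 10)
      simp only [Expr.cost]
      refine le_trans (le_of_eq ?_) this
      ring
  refine (Runs.seq (T := n * ((domTm.cost + 25) * (n + 1) ^ 2 + 4) + 4)
    (Runs.setReg (x := .const 0) (Q := inv 0) (Nat.zero_lt_of_lt hW) ?_) fun υ hυ =>
    (Runs.while (inv := inv) (by nlinarith) (by omega) (fun k φ hφ => ⟨hφ.2.2.1, hφ.1.reg_zero⟩)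
      outer hυ).mono le_rfl ?_).mono ?_ fun _ h => h
  · exact ⟨hS.setReg (by norm_num) (Nat.zero_le _), hG.setReg (by norm_num) _, by simp [Expr.eval],
      fun x y hx => (Nat.not_lt_zero _ hx).elim⟩
  · exact fun τ ⟨h1, h2, _, h4⟩ => ⟨h1, h2, fun x y => h4 x y x.2⟩
  · have := loop_time_le (n := n) (K := domTm.cost + 25) (m := 2) (c := 4) (c' := 11)
    simp only [Expr.cost]
    refine le_trans ?_ this
    omega

theorem runs_twinsProgram (hc : twinsTm.deg < c) (hc3 : 3 ≤ c) (hS : Small n 5 σ)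
    (hG : Holds G σ) (hD : HasTable 1 (Dom2 G) σ) :
    Runs ((n + 2) ^ c) twinsProgram σ ((twinsTm.cost + 20) * (n + 1) ^ 3)
      fun τ => Small n 5 τ ∧ Holds G τ ∧ HasTable 1 (Dom2 G) τ ∧
        ∀ u : Fin n, τ.arr 2 u = (twins G u).card := by
  have hW3 : (n + 2) ^ 3 ≤ (n + 2) ^ c := Nat.pow_le_pow_right (by omega) hc3
  have hW : n * n + 2 * n + 2 < (n + 2) ^ c := by
    refine lt_of_lt_of_le ?_ hW3
    ring_nf
    nlinarith
  let inv : ℕ → Store → Prop := fun k τ => Small n 5 τ ∧ Holds G τ ∧ HasTable 1 (Dom2 G) τ ∧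
    τ.reg 1 = k ∧ ∀ x : Fin n, (x : ℕ) < k → τ.arr 2 x = (twins G x).card
  have hdepth : twinsTm.depth = 2 := by
    simp [twinsTm, Tm.all, Tm.or, Tm.iff, Tm.cAdj, Tm.same, Tm.entry, Tm.depth]
  have body : ∀ k τ, k < n → inv k τ → Runs ((n + 2) ^ c)
      (.seq (twinsTm.assign 5 2 (.reg 1)) (.incr 1)) τ
      (twinsTm.cost * (n + 1) ^ 2 + 3 + 4) (inv (k + 1)) := by
    rintro k τ hk ⟨h1, h2, h3, h4, h5⟩
    have ht := h2.eval_twinsTm (x := ⟨k, hk⟩) h4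
    have hle : (twins G ⟨k, hk⟩).card ≤ n := (Finset.card_le_univ _).trans_eq (Fintype.card_fin n)
    have hrun := Tm.runs_assign (a := 2) (x := .reg 1) (k := k) (by norm_num) twinsTm_below hc
      (fun υ hυ => ?_) h1
    · rw [hdepth] at hrun
      refine hrun.seq fun υ hυ => ?_
      obtain ⟨r, a⟩ := hυ
      have e1 := (r 1 (by norm_num)).trans h4
      refine Runs.incr (by rw [e1]; nlinarith) ⟨?_, ?_, ?_, ?_, fun x hx => ?_⟩
      · exact (h1.of_assign (by norm_num) (by omega) r a).setReg (by norm_num) (by omega)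
      · exact (h2.of_assign (by norm_num) (by norm_num) r a).setReg (by norm_num) _
      · intro x y
        rw [Store.setReg_arr, a, if_neg (by simp)]
        exact h3 x y
      · simp [e1]
      · rw [Store.setReg_arr, a]
        by_cases hxk : (x : ℕ) = k
        · rw [if_pos ⟨rfl, hxk⟩, ht]
          subst hxk
          rfl
        · rw [if_neg fun h => hxk h.2]
          exact h5 x (by omega)
    · have e1 := (hυ.reg 1 (by norm_num)).trans h4
      simp only [Expr.Fits, Expr.eval, e1, and_true]
      nlinarith
  refine (Runs.seq (T := n * (twinsTm.cost * (n + 1) ^ 2 + 3 + 4 + 4) + 4)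
    (Runs.setReg (x := .const 0) (Q := inv 0) (Nat.zero_lt_of_lt hW) ?_) fun υ hυ =>
    (Runs.while (inv := inv) (by nlinarith) (by omega) (fun k φ hφ => ⟨hφ.2.2.2.1, hφ.1.reg_zero⟩)
      body hυ).mono le_rfl ?_).mono ?_ fun _ h => h
  · exact ⟨hS.setReg (by norm_num) (Nat.zero_le _), hG.setReg (by norm_num) _, hD,
      by simp [Expr.eval], fun x hx => (Nat.not_lt_zero _ hx).elim⟩
  · exact fun τ ⟨h1, h2, h3, _, h4⟩ => ⟨h1, h2, h3, fun x => h4 x x.2⟩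
  · have := loop_time_le (n := n) (K := twinsTm.cost) (m := 2) (c := 11) (c' := 9)
    simp only [Expr.cost]
    refine le_trans ?_ this
    simp only [add_assoc]
    norm_num
    omega

theorem runs_gammaProgram (hc1 : domTm.deg < c) (hc2 : twinsTm.deg < c) (hc3 : 3 ≤ c)
    (hc4 : gammaTm.deg < c) (hS : Small n 5 σ) (hG : Holds G σ) (hconn : G.Connected)
    (ht : Typed G) :
    Runs ((n + 2) ^ c) gammaProgram σ
      ((domTm.cost + 40 + (twinsTm.cost + 20 + (gammaTm.cost + 2))) * (n + 1) ^ 3)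
      fun τ => τ.reg 0 = gammaR G := by
  have main : Runs ((n + 2) ^ c) (.seq domProgram (.seq twinsProgram
      (.seq (gammaTm.compile 5) (.setReg 0 (.reg 5))))) σ _ _ := (runs_domProgram hc1 hc3 hS hG).seq fun τ ⟨h1, h2, h3⟩ =>
    (runs_twinsProgram hc2 hc3 h1 h2 h3).seq fun τ ⟨h1, h2, h3, h4⟩ =>
    (gammaTm.runs_compile (by norm_num) gammaTm_below hc4 le_rfl h1).seq (T := 2)
      (Q := fun τ => τ.reg 0 = gammaR G) fun υ hυ => by
        have hval := h2.eval_gammaTm h3 h4 hconn ht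
        refine Runs.setReg (x := .reg 5) ?_ ?_
        · exact hυ.2.trans_lt
            ((Tm.eval_le gammaTm_below h1).trans_lt (Nat.pow_lt_pow_right (by omega) hc4))
        · simp [Expr.eval, hυ.2, hval]
  refine main.mono ?_ fun _ h => h
  have : 1 ≤ (n + 1) ^ 3 := Nat.one_le_pow _ _ (by omega)
  -- Reading domination and twin numbers from tables keeps this depth at three; expanding domination
  -- inside the secure-pair test would make it four.
  rw [gammaTm_depth]
  nlinarith

theorem holds_graphInput (G : SimpleGraph (Fin n)) : Holds G (graphInput G) := by
  classical
  refine ⟨by simp [graphInput], fun x y => ?_⟩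
  have : (∃ i j : Fin n, n * (x : ℕ) + y = n * i + j ∧ G.Adj i j) ↔ G.Adj x y := by
    refine ⟨?_, fun h => ⟨x, y, rfl, h⟩⟩
    rintro ⟨i, j, hij, h⟩
    obtain ⟨h1, h2⟩ := add_mul_inj y.2 j.2 hij
    rwa [Fin.ext h1, Fin.ext h2]
  simp only [graphInput, this, true_and]
  by_cases h : G.Adj x y <;> simp [IsTruth, h]

theorem small_graphInput (G : SimpleGraph (Fin n)) (e : ℕ) : Small n e (graphInput G) := by
  refine ⟨by simp [graphInput], fun r _ => ?_, fun a k => ?_⟩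
  · simp only [graphInput]
    split_ifs <;> omega
  · simp only [graphInput]
    split_ifs <;> omega

end Program

end WeakRoman

/-- There are a single word RAM program and constants `c`, `C` such that, for every connected
`P₄`-sparse graph `G` on `n` vertices, given by its adjacency matrix, the program, run with words of
`O(log n)` bits (values below `(n + 2) ^ c`), halts after at most `C * n ^ 3` steps with the weak
Roman domination number of `G` in register `0`. -/
theorem theorem7 :
    ∃ (P : WeakRoman.Program) (c C : ℕ), ∀ (n : ℕ) (G : SimpleGraph (Fin n)),
      G.Connected → WeakRoman.IsP4Sparse G →
        ∃ (t : ℕ) (τ : WeakRoman.Store),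
          WeakRoman.Exec ((n + 2) ^ c) P (WeakRoman.graphInput G) t τ ∧
            τ.reg 0 = WeakRoman.gammaR G ∧ t ≤ C * n ^ 3 := by
  -- The exponent strictly exceeds the degree of each term, and the summand 3 leaves room for the
  -- cell indices of the tables.
  obtain ⟨c, hc⟩ : ∃ c, c = WeakRoman.domTm.deg + WeakRoman.twinsTm.deg +
    WeakRoman.gammaTm.deg + 3 := ⟨_, rfl⟩
  obtain ⟨C, hC⟩ : ∃ C, C = WeakRoman.domTm.cost + 40 + (WeakRoman.twinsTm.cost + 20 +
    (WeakRoman.gammaTm.cost + 2)) := ⟨_, rfl⟩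
  refine ⟨WeakRoman.gammaProgram, c, C * 8, fun n G hG hP => ?_⟩
  obtain ⟨t, τ, h1, h2, h3⟩ := WeakRoman.runs_gammaProgram (c := c) (by omega) (by omega)
    (by omega) (by omega) (WeakRoman.small_graphInput G 5) (WeakRoman.holds_graphInput G) hG
    hP.typed
  rw [← hC] at h2
  refine ⟨t, τ, h1, h3, h2.trans ?_⟩
  obtain ⟨v⟩ := hG.nonempty
  have hn : 1 ≤ n := Nat.one_le_of_lt v.2
  -- A connected graph has a vertex, so `n + 1 ≤ 2 * n`; this is the source of the factor 8.
  have : (n + 1) ^ 3 ≤ 8 * n ^ 3 := by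
    calc (n + 1) ^ 3 ≤ (2 * n) ^ 3 := Nat.pow_le_pow_left (by omega) 3
      _ = 8 * n ^ 3 := by ring
  rw [mul_assoc]
  exact Nat.mul_le_mul_left _ this
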